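/- Theorem 2.3 (stability constant). Let $n\in\{2,3\}$, let $T\subset\mathbb R^n$ be a (nondegenerate) simplex, let $p\in\mathbb N_0$, and let $H^1(T):=H^1(\operatorname{int}T)$. Let $P_m(T)$ (resp. $P_m(T;\mathbb R^n)$) denote the polynomials (resp. polynomial vector fields) of total degree at most $m$. Let $\Pi_p$ be the componentwise $L^2$ projection onto $P_p(T;\mathbb R^n)$. For $f\in H^1(T)$ let $G_{p+1}f\in P_{p+1}(T)$ be the unique polynomial that has the same integral mean over $T$ as $f$ and satisfies $(\nabla G_{p+1}f,\nabla w)_{L^2(T)}=(\nabla f,\nabla w)_{L^2(T)}$ for all $w\in P_{p+1}(T)$. Let $C_{\mathrm{st},2}$ be the best constant, i.e. the smallest $C\ge 0$ with $$\|\nabla(1-G_{p+1})f\|_{L^2(T)}\le C\,\|(1-\Pi_p)\nabla f\|_{L^2(T)}\qquad\text{for all } f\in H^1(T).$$ Write $\operatorname{curl}q=\partial_1q_2-\partial_2q_1$ for $n=2$ and $\operatorname{curl}q=(\partial_2q_3-\partial_3q_2,\ \partial_3q_1-\partial_1q_3,\ \partial_1q_2-\partial_2q_1)$ for $n=3$.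 For $g\in L^2(T;\mathbb R^{2n-3})$ let $|||g|||_*=\sup\{\int_T v\cdot g\,dx/\|\nabla v\|_{L^2(T)} : v\in H^1_0(T;\mathbb R^{2n-3})\setminus\{0\}\}$ be its norm in $H^{-1}(T;\mathbb R^{2n-3})$, and let $(-\Delta)^{-1}g\in H^1_0(T;\mathbb R^{2n-3})$ be the componentwise weak solution $v$ of $-\Delta v=g$ in $T$. Let $Q_p$ be the $L^2$ orthogonal complement of $\nabla P_{p+1}(T)$ in $P_p(T;\mathbb R^n)$ and, for $q,r\in Q_p$, let $$\mathfrak a(q,r)=(q,r)_{L^2(T)},\qquad \mathfrak b(q,r)=((-\Delta)^{-1}\operatorname{curl}q,\operatorname{curl}r)_{L^2(T)}.$$ If $p\ge1$, then the maximum $$m_p^2:=\max_{q\in P_p(T;\mathbb R^n),\ \operatorname{curl}q\ne0}\ \min_{v\in P_{p+1}(T)}\frac{\|q-\nabla v\|_{L^2(T)}^2}{|||\operatorname{curl}q|||_*^2}$$ exists (all the minima are attained) and equals the largest eigenvalue $\lambda$ of the eigenvalue problem of finding $\lambda\in\mathbb R$ and $q\in Q_p\setminus\{0\}$ with $\mathfrak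 a(q,r)=\lambda\,\mathfrak b(q,r)$ for all $r\in Q_p$. If $p=0$ (no admissible $q$ exists and $Q_0=\{0\}$), set $m_0:=0$. For all $p\in\mathbb N_0$, $C_{\mathrm{st},2}$ exists (as a finite smallest constant), and with $m_p\ge 0$, $$C_{\mathrm{st},2}\le\max\{1,\,m_pC_n\},\qquad C_2=1,\quad C_3=2/\sqrt3 .$$ -/

import Mathlib

open MeasureTheory
open scoped ContDiff ENNReal RealInnerProductSpace

noncomputable section

namespace StabConst

/-- The Euclidean space `ℝⁿ`. -/
abbrev E (n : ℕ) : Type := EuclideanSpace ℝ (Fin n)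

/-- Real polynomials in `n` variables. -/
abbrev Poly (n : ℕ) : Type := MvPolynomial (Fin n) ℝ

variable {n : ℕ}

/-! ### The simplex and its Lebesgue spaces -/

/-- The (closed) simplex as a subset of `ℝⁿ`. -/
def body (T : Affine.Simplex ℝ (E n) n) : Set (E n) := convexHull ℝ (Set.range T.points)

/-- The Lebesgue measure on the interior `int(T)` of the simplex. -/
def vol (T : Affine.Simplex ℝ (E n) n) : Measure (E n) := volume.restrict (interior (body T))

/-- The Hilbert space `L²(T; F)`. -/
abbrev L2 (T : Affine.Simplex ℝ (E n) n) (F : Type) [NormedAddCommGroup F] : Type :=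
  Lp F 2 (vol T)

theorem isCompact_body (T : Affine.Simplex ℝ (E n) n) : IsCompact (body T) :=
  Set.Finite.isCompact_convexHull ℝ (Set.finite_range T.points)

theorem interior_body_nonempty (T : Affine.Simplex ℝ (E n) n) : (interior (body T)).Nonempty := by
  have h : affineSpan ℝ (Set.range T.points) = ⊤ :=
    (AffineIndependent.affineSpan_eq_top_iff_card_eq_finrank_add_one T.independent).2 (by simp)
  exact interior_convexHull_nonempty_iff_affineSpan_eq_top.2 h

instance isFiniteMeasure_vol (T : Affine.Simplex ℝ (E n) n) : IsFiniteMeasure (vol T) := by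
  refine ⟨?_⟩
  rw [vol, Measure.restrict_apply_univ]
  exact (measure_mono interior_subset).trans_lt (isCompact_body T).measure_lt_top

theorem vol_univ_ne_zero (T : Affine.Simplex ℝ (E n) n) : vol T Set.univ ≠ 0 := by
  rw [vol, Measure.restrict_apply_univ]
  exact (isOpen_interior.measure_pos _ (interior_body_nonempty T)).ne'

theorem memLp_of_continuous {F : Type} [NormedAddCommGroup F] (T : Affine.Simplex ℝ (E n) n)
    {f : E n → F} (hf : Continuous f) [SecondCountableTopologyEither (E n) F] :
    MemLp f 2 (vol T) := by
  obtain ⟨C, hC⟩ := (isCompact_body T).exists_bound_of_continuousOn hf.continuousOn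
  refine MemLp.of_bound hf.aestronglyMeasurable C ?_
  rw [vol]
  filter_upwards [ae_restrict_mem isOpen_interior.measurableSet] with x hx
  exact hC x (interior_subset hx)

/-! ### Polynomials -/

/-- `P_p`: polynomials of total degree at most `p`. -/
abbrev P (n p : ℕ) : Submodule ℝ (Poly n) := MvPolynomial.restrictTotalDegree (Fin n) ℝ p

/-- `P_p(T; ℝⁿ)`: vector fields all of whose components are polynomials of total degree at most
`p`. -/
def vecP (n p : ℕ) : Submodule ℝ (Fin n → Poly n) := Submodule.pi Set.univ fun _ => P n p

/-- The gradient of a polynomial. -/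
def grad : Poly n →ₗ[ℝ] (Fin n → Poly n) :=
  LinearMap.pi fun i => (MvPolynomial.pderiv i : Derivation ℝ (Poly n) (Poly n)).toLinearMap

/-- The curl of a polynomial vector field, with `2 n - 3` components:
`∂₁q₂ - ∂₂q₁` for `n = 2` and `(∂₂q₃ - ∂₃q₂, ∂₃q₁ - ∂₁q₃, ∂₁q₂ - ∂₂q₁)` for `n = 3`
(coordinates are indexed from `0` in the code; other values of `n` are not used). -/
def curl : {n : ℕ} → (Fin n → Poly n) → (Fin (2 * n - 3) → Poly n)
  | 2, q => fun _ => MvPolynomial.pderiv 0 (q 1) - MvPolynomial.pderiv 1 (q 0)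
  | 3, q =>
    ![MvPolynomial.pderiv 1 (q 2) - MvPolynomial.pderiv 2 (q 1),
      MvPolynomial.pderiv 2 (q 0) - MvPolynomial.pderiv 0 (q 2),
      MvPolynomial.pderiv 0 (q 1) - MvPolynomial.pderiv 1 (q 0)]
  | _, _ => 0

/-- The polynomial function on `ℝⁿ` defined by a polynomial. -/
def evalFun (v : Poly n) (x : E n) : ℝ := MvPolynomial.eval (fun i => x i) v

/-- The vector field on `ℝⁿ` defined by a vector of polynomials. -/
def evalVec (q : Fin n → Poly n) (x : E n) : E n := WithLp.toLp 2 fun i => evalFun (q i) x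

theorem continuous_evalFun (v : Poly n) : Continuous (evalFun v) :=
  (MvPolynomial.continuous_eval v).comp (by fun_prop)

theorem continuous_evalVec (q : Fin n → Poly n) : Continuous (evalVec q) :=
  (PiLp.continuous_toLp 2 _).comp (continuous_pi fun i => continuous_evalFun (q i))

/-- A polynomial as an element of `L²(T)`. -/
def polyL2 (T : Affine.Simplex ℝ (E n) n) : Poly n →ₗ[ℝ] L2 T ℝ where
  toFun v := (memLp_of_continuous T (continuous_evalFun v)).toLp (evalFun v)
  map_add' v w := by
    rw [← MemLp.toLp_add]
    congr 1
    ext x; simp [evalFun]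
  map_smul' c v := by
    rw [RingHom.id_apply, ← MemLp.toLp_const_smul]
    congr 1
    ext x; simp [evalFun, MvPolynomial.smul_eval]

/-- A polynomial vector field as an element of `L²(T; ℝⁿ)`. -/
def vecL2 (T : Affine.Simplex ℝ (E n) n) : (Fin n → Poly n) →ₗ[ℝ] L2 T (E n) where
  toFun q := (memLp_of_continuous T (continuous_evalVec q)).toLp (evalVec q)
  map_add' v w := by
    rw [← MemLp.toLp_add]
    congr 1
    ext x i; simp [evalVec, evalFun]
  map_smul' c v := by
    rw [RingHom.id_apply, ← MemLp.toLp_const_smul]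
    congr 1
    ext x i; simp [evalVec, evalFun, MvPolynomial.smul_eval]

instance finite_vecP (n p : ℕ) : Module.Finite ℝ (vecP n p) := by
  let F : vecP n p →ₗ[ℝ] (Fin n → P n p) :=
    LinearMap.pi fun i => ((LinearMap.proj i).comp (vecP n p).subtype).codRestrict (P n p)
      fun q => q.2 i (Set.mem_univ i)
  refine Module.Finite.of_injective F fun q r h => ?_
  ext1
  funext i
  exact congrArg Subtype.val (congrFun h i)

/-- The `L²` projection `Π_p` onto `P_p(T; ℝⁿ)`, which acts componentwise. -/
def proj (T : Affine.Simplex ℝ (E n) n) (p : ℕ) : L2 T (E n) →L[ℝ] L2 T (E n) :=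
  ((vecP n p).map (vecL2 T)).starProjection

/-! ### Sobolev spaces -/

/-- Smooth functions with compact support in `int(T)`. -/
def IsTest (T : Affine.Simplex ℝ (E n) n) (φ : E n → ℝ) : Prop :=
  ContDiff ℝ ∞ φ ∧ HasCompactSupport φ ∧ tsupport φ ⊆ interior (body T)

/-- The Hilbert space `L²(T) × L²(T; ℝⁿ)`, in which Sobolev functions `f` are represented by the
pairs `(f, ∇f)`. The norm of the pair is the usual norm of `H¹(T)`. -/
abbrev Pairs (T : Affine.Simplex ℝ (E n) n) : Type := WithLp 2 (L2 T ℝ × L2 T (E n))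

/-- `H¹(T) = H¹(int(T))`: all pairs `(f, ∇f)` of `f ∈ L²(T)` and its weak gradient
`∇f ∈ L²(T; ℝⁿ)`. -/
def H1 (T : Affine.Simplex ℝ (E n) n) : Set (Pairs T) :=
  {u | ∀ φ : E n → ℝ, IsTest T φ → ∀ i : Fin n,
    ∫ x, u.fst x * gradient φ x i ∂(vol T) = -∫ x, u.snd x i * φ x ∂(vol T)}

/-- The pairs `(φ, ∇φ)` for smooth functions `φ` with compact support in `int(T)`. -/
def testPairs (T : Affine.Simplex ℝ (E n) n) : Submodule ℝ (Pairs T) where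
  carrier := {u | ∃ φ : E n → ℝ, IsTest T φ ∧ u.fst =ᵐ[vol T] φ ∧ u.snd =ᵐ[vol T] gradient φ}
  zero_mem' := by
    refine ⟨0, ⟨contDiff_const, HasCompactSupport.zero, by simp [tsupport]⟩, ?_, ?_⟩
    · exact Lp.coeFn_zero _ _ _
    · refine (Lp.coeFn_zero _ _ _).trans ?_
      filter_upwards with x
      simp [gradient]
  add_mem' := by
    rintro u v ⟨φ, ⟨h1, h2, h3⟩, h4, h5⟩ ⟨ψ, ⟨k1, k2, k3⟩, k4, k5⟩
    refine ⟨φ + ψ, ⟨h1.add k1, h2.add k2, ?_⟩, ?_, ?_⟩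
    · exact (tsupport_add φ ψ).trans (Set.union_subset h3 k3)
    · filter_upwards [Lp.coeFn_add u.fst v.fst, h4, k4] with x a b c
      simpa [b, c] using a
    · filter_upwards [Lp.coeFn_add u.snd v.snd, h5, k5] with x a b c
      rw [WithLp.add_snd, a, Pi.add_apply, b, c]
      have d1 : DifferentiableAt ℝ φ x := h1.contDiffAt.differentiableAt (by simp)
      have d2 : DifferentiableAt ℝ ψ x := k1.contDiffAt.differentiableAt (by simp)
      simp [gradient, fderiv_add d1 d2]
  smul_mem' := by
    rintro c u ⟨φ, ⟨h1, h2, h3⟩, h4, h5⟩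
    refine ⟨c • φ, ⟨h1.const_smul c, h2.smul_left (f := fun _ => c), ?_⟩, ?_, ?_⟩
    · exact (closure_mono (Function.support_const_smul_subset c φ)).trans h3
    · filter_upwards [Lp.coeFn_smul c u.fst, h4] with x a b
      simpa [b] using a
    · filter_upwards [Lp.coeFn_smul c u.snd, h5] with x a b
      rw [WithLp.smul_snd, a, Pi.smul_apply, b]
      have d1 : DifferentiableAt ℝ φ x := h1.contDiffAt.differentiableAt (by simp)
      simp [gradient, fderiv_const_smul d1]

/-- `H¹₀(T)`: the closure of the smooth functions with compact support in `int(T)` in the norm of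
`H¹(T)`; its elements are the pairs `(v, ∇v)`. -/
def H10 (T : Affine.Simplex ℝ (E n) n) : Submodule ℝ (Pairs T) := (testPairs T).topologicalClosure

/-! ### The Galerkin projection -/

/-- `g` is the Galerkin projection `G_m f ∈ P_m(T)` of `f`, where `u = (f, ∇f)`: the integral means
over `T` agree, and `∇(f - g)` is `L²` orthogonal to `∇P_m(T)`. -/
def IsGalerkin (T : Affine.Simplex ℝ (E n) n) (m : ℕ) (u : Pairs T) (g : Poly n) : Prop :=
  g ∈ P n m ∧ ⨍ x, evalFun g x ∂(vol T) = ⨍ x, u.fst x ∂(vol T) ∧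
    ∀ w ∈ P n m, ⟪vecL2 T (grad g), vecL2 T (grad w)⟫ = ⟪u.snd, vecL2 T (grad w)⟫

theorem eq_zero_of_evalFun_eq_zero (T : Affine.Simplex ℝ (E n) n) (v : Poly n)
    (h : ∀ x ∈ interior (body T), evalFun v x = 0) : v = 0 := by
  obtain ⟨x₀, hx₀⟩ := interior_body_nonempty T
  have hO : IsOpen ((fun y : Fin n → ℝ => (WithLp.toLp 2 y : E n)) ⁻¹' interior (body T)) :=
    isOpen_interior.preimage (PiLp.continuous_toLp 2 _)
  obtain ⟨ε, hε, hb⟩ := Metric.isOpen_iff.1 hO (WithLp.ofLp x₀) hx₀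
  refine MvPolynomial.funext_set (fun i => Metric.ball (x₀ i) ε) (fun i => ?_) fun y hy => ?_
  · rw [Real.ball_eq_Ioo]
    exact Set.Ioo_infinite (by linarith)
  · have hy' : y ∈ Metric.ball (WithLp.ofLp x₀) ε := by
      rw [ball_pi _ hε]
      exact hy
    simpa [evalFun] using h _ (hb hy')

theorem ae_zero_imp (T : Affine.Simplex ℝ (E n) n) (v : Poly n)
    (h : ∀ᵐ x ∂(vol T), evalFun v x = 0) : v = 0 := by
  refine eq_zero_of_evalFun_eq_zero T v fun x hx => ?_
  have := Measure.eqOn_open_of_ae_eq (μ := (volume : Measure (E n))) (f := evalFun v)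
    (g := fun _ => 0) h isOpen_interior (continuous_evalFun v).continuousOn continuousOn_const
  exact this hx

theorem eq_C_of_grad_eq_zero (v : Poly n) (h : grad v = 0) : v = MvPolynomial.C (v.coeff 0) := by
  ext m
  rw [MvPolynomial.coeff_C]
  split_ifs with hm
  · rw [hm]
  · obtain ⟨i, hi⟩ : ∃ i, m i ≠ 0 := by
      by_contra! H
      exact hm (Finsupp.ext fun i => (H i).symm)
    have h1 : MvPolynomial.pderiv i v = 0 := congrFun h i
    have h2 := MvPolynomial.coeff_pderiv (i := i) v (m - Finsupp.single i 1)
    have h3 : m - Finsupp.single i 1 + Finsupp.single i 1 = m :=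
      tsub_add_cancel_of_le (by simpa [Nat.one_le_iff_ne_zero] using hi)
    rw [h1, h3] at h2
    simp only [MvPolynomial.coeff_zero] at h2
    rcases mul_eq_zero.1 h2.symm with h | h
    · exact h
    · exact absurd h (by positivity)

theorem vecL2_injective (T : Affine.Simplex ℝ (E n) n) (q : Fin n → Poly n)
    (h : vecL2 T q = 0) : q = 0 := by
  have h1 : evalVec q =ᵐ[vol T] 0 :=
    (MemLp.coeFn_toLp (memLp_of_continuous T (continuous_evalVec q))).symm.trans
      ((Lp.eq_zero_iff_ae_eq_zero).1 h)
  funext i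
  refine ae_zero_imp T _ ?_
  filter_upwards [h1] with x hx
  have := congrArg (fun y : E n => y i) hx
  simpa [evalVec] using this

theorem existsUnique_galerkin (T : Affine.Simplex ℝ (E n) n) (m : ℕ) (u : Pairs T) :
    ∃! g : Poly n, IsGalerkin T m u g := by
  have hint : ∀ v : Poly n, Integrable (evalFun v) (vol T) := fun v =>
    (memLp_of_continuous T (continuous_evalFun v)).integrable (by norm_num)
  have hne : NeZero (vol T) := ⟨fun h => vol_univ_ne_zero T (by simp [h])⟩
  have hC : ∀ (v : Poly n) (c : ℝ), ⨍ x, evalFun (v + MvPolynomial.C c) x ∂(vol T)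
      = ⨍ x, evalFun v x ∂(vol T) + c := by
    intro v c
    have e : evalFun (v + MvPolynomial.C c) = fun x => evalFun v x + c := by
      ext x; simp [evalFun]
    rw [e, average_eq, average_eq, integral_add (hint v) (integrable_const c), smul_add]
    congr 1
    rw [← average_eq, average_const]
  have hgC : ∀ c : ℝ, grad (MvPolynomial.C c : Poly n) = 0 := by
    intro c; ext1 i; simp [grad]
  refine existsUnique_of_exists_of_unique ?_ ?_
  · let K := ((P n m).map (grad (n := n))).map (vecL2 T)
    obtain ⟨_, ⟨w, hw, rfl⟩, hw2⟩ : K.starProjection u.snd ∈ K := K.starProjection_apply_mem _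
    refine ⟨w + MvPolynomial.C (⨍ x, u.fst x ∂(vol T) - ⨍ x, evalFun w x ∂(vol T)), ?_, ?_, ?_⟩
    · refine Submodule.add_mem _ hw ?_
      rw [MvPolynomial.mem_restrictTotalDegree, MvPolynomial.totalDegree_C]
      exact Nat.zero_le m
    · rw [hC]; ring
    · intro z hz
      rw [map_add, hgC, add_zero, hw2]
      have hzK : vecL2 T (grad z) ∈ K := ⟨_, ⟨z, hz, rfl⟩, rfl⟩
      have := K.starProjection_inner_eq_zero u.snd _ hzK
      rw [inner_sub_left] at this
      linarith
  · rintro g g' ⟨hg, hg1, hg2⟩ ⟨hg', hg1', hg2'⟩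
    have hd : grad (g - g') = 0 := by
      refine vecL2_injective T _ ?_
      rw [← inner_self_eq_zero (𝕜 := ℝ)]
      have h1 := hg2 (g - g') (Submodule.sub_mem _ hg hg')
      have h2 := hg2' (g - g') (Submodule.sub_mem _ hg hg')
      nth_rw 1 [map_sub, map_sub]
      rw [inner_sub_left, h1, h2, sub_self]
    have h3 := eq_C_of_grad_eq_zero _ hd
    have h4 : g = g' + MvPolynomial.C ((g - g').coeff 0) := by rw [← h3]; ring
    have h5 : (g - g').coeff 0 = 0 := by
      have := hC g' ((g - g').coeff 0)
      rw [← h4, hg1, hg1'] at this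
      linarith
    rw [h4, h5]; simp

/-- The Galerkin projection `G_m f ∈ P_m(T)` of `f`, where `u = (f, ∇f)`. -/
def galerkin (T : Affine.Simplex ℝ (E n) n) (m : ℕ) (u : Pairs T) : Poly n :=
  (existsUnique_galerkin T m u).choose

/-! ### The inverse Laplacian -/

theorem exists_exponent (hn : 2 ≤ n) : ∃ p : NNReal, 1 ≤ p ∧ p ≤ 2 ∧
    p < (Module.finrank ℝ (E n) : NNReal) ∧
    (p : ℝ)⁻¹ - (Module.finrank ℝ (E n) : ℝ)⁻¹ ≤ ((2 : NNReal) : ℝ)⁻¹ := by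
  rw [finrank_euclideanSpace_fin]
  rcases hn.eq_or_lt with h | h
  · exact ⟨1, le_rfl, by norm_num, by rw [← h]; norm_num, by rw [← h]; norm_num⟩
  · exact ⟨2, by norm_num, le_rfl, by exact_mod_cast h, by simp⟩

theorem gns (T : Affine.Simplex ℝ (E n) n) {p : NNReal} (hp1 : 1 ≤ p)
    (hpn : p < (Module.finrank ℝ (E n) : NNReal))
    (hpq : (p : ℝ)⁻¹ - (Module.finrank ℝ (E n) : ℝ)⁻¹ ≤ ((2 : NNReal) : ℝ)⁻¹) :
    ∃ A : NNReal, ∀ φ : E n → ℝ, IsTest T φ →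
      eLpNorm φ 2 (volume : Measure (E n)) ≤ A * eLpNorm (fderiv ℝ φ) p volume := by
  have hbd : Bornology.IsBounded (interior (body T)) :=
    (isCompact_body T).isBounded.subset interior_subset
  refine ⟨eLpNormLESNormFDerivOfLeConst ℝ (volume : Measure (E n)) (interior (body T)) p 2,
    fun φ h => ?_⟩
  exact eLpNorm_le_eLpNorm_fderiv_of_le (volume : Measure (E n)) (h.1.of_le (by simp))
    ((subset_tsupport φ).trans h.2.2) hp1 hpn hpq hbd

theorem holder (T : Affine.Simplex ℝ (E n) n) {p : NNReal} (hp2 : p ≤ 2) :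
    ∃ B : ℝ≥0∞, B ≠ ⊤ ∧ ∀ φ : E n → ℝ, IsTest T φ →
      eLpNorm (fderiv ℝ φ) p (vol T) ≤ eLpNorm (fderiv ℝ φ) 2 (vol T) * B := by
  refine ⟨vol T Set.univ ^ (1 / (p : ℝ≥0∞).toReal - 1 / (2 : ℝ≥0∞).toReal),
    ENNReal.rpow_ne_top_of_ne_zero (vol_univ_ne_zero T) (measure_ne_top _ _), fun φ h => ?_⟩
  exact eLpNorm_le_eLpNorm_mul_rpow_measure_univ (by exact_mod_cast hp2)
    (h.1.continuous_fderiv (by simp)).aestronglyMeasurable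

theorem eLpNorm_test_le (hn : 2 ≤ n) (T : Affine.Simplex ℝ (E n) n) :
    ∃ K : ℝ≥0∞, K ≠ ⊤ ∧ ∀ φ : E n → ℝ, IsTest T φ →
      eLpNorm φ 2 (vol T) ≤ K * eLpNorm (gradient φ) 2 (vol T) := by
  obtain ⟨p, hp1, hp2, hpn, hpq⟩ := exists_exponent hn
  obtain ⟨A, hA⟩ := gns T hp1 hpn hpq
  obtain ⟨B, hB, hB'⟩ := holder T hp2
  refine ⟨A * B, ENNReal.mul_ne_top ENNReal.coe_ne_top hB, fun φ hφ => ?_⟩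
  have hs : Function.support (fun x => ‖fderiv ℝ φ x‖) ⊆ interior (body T) := by
    intro x hx
    exact hφ.2.2 (support_fderiv_subset ℝ fun h0 => hx (by simp [h0]))
  have e1 : eLpNorm (fderiv ℝ φ) p volume = eLpNorm (fderiv ℝ φ) p (vol T) := by
    rw [vol, ← eLpNorm_norm, ← eLpNorm_norm (fderiv ℝ φ),
      eLpNorm_restrict_eq_of_support_subset hs]
  have e3 : eLpNorm (fderiv ℝ φ) 2 (vol T) = eLpNorm (gradient φ) 2 (vol T) := by
    refine eLpNorm_congr_norm_ae (Filter.Eventually.of_forall fun x => ?_)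
    simp [gradient]
  calc eLpNorm φ 2 (vol T) ≤ eLpNorm φ 2 volume := eLpNorm_restrict_le _ _ _ _
    _ ≤ A * eLpNorm (fderiv ℝ φ) p volume := hA φ hφ
    _ ≤ A * (eLpNorm (fderiv ℝ φ) 2 (vol T) * B) := by
      rw [e1]
      exact mul_le_mul_right (hB' φ hφ) _
    _ = (A * B) * eLpNorm (gradient φ) 2 (vol T) := by rw [e3]; ring

theorem poincare_test (hn : 2 ≤ n) (T : Affine.Simplex ℝ (E n) n) :
    ∃ C : ℝ, 0 ≤ C ∧ ∀ v ∈ testPairs T, ‖v.fst‖ ≤ C * ‖v.snd‖ := by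
  obtain ⟨K, hK, h⟩ := eLpNorm_test_le hn T
  refine ⟨K.toReal, ENNReal.toReal_nonneg, ?_⟩
  rintro v ⟨φ, hφ, h4, h5⟩
  have n1 : ‖v.fst‖ = (eLpNorm φ 2 (vol T)).toReal := by
    rw [Lp.norm_def]
    exact congrArg ENNReal.toReal (eLpNorm_congr_ae h4)
  have n2 : ‖v.snd‖ = (eLpNorm (gradient φ) 2 (vol T)).toReal := by
    rw [Lp.norm_def]
    exact congrArg ENNReal.toReal (eLpNorm_congr_ae h5)
  have n3 : eLpNorm (gradient φ) 2 (vol T) ≠ ⊤ := by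
    have := Lp.eLpNorm_ne_top v.snd
    rwa [eLpNorm_congr_ae h5] at this
  rw [n1, n2, ← ENNReal.toReal_mul]
  exact ENNReal.toReal_mono (ENNReal.mul_ne_top hK n3) (h φ hφ)

theorem poincare (hn : 2 ≤ n) (T : Affine.Simplex ℝ (E n) n) :
    ∃ C : ℝ, 0 ≤ C ∧ ∀ v ∈ H10 T, ‖v.fst‖ ≤ C * ‖v.snd‖ := by
  obtain ⟨C, hC, h⟩ := poincare_test hn T
  refine ⟨C, hC, fun v hv => ?_⟩
  have hcl : IsClosed {w : Pairs T | ‖w.fst‖ ≤ C * ‖w.snd‖} :=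
    isClosed_le (by fun_prop) (by fun_prop)
  exact closure_minimal (s := (testPairs T : Set (Pairs T))) h hcl hv

instance completeSpace_H10 (T : Affine.Simplex ℝ (E n) n) : CompleteSpace (H10 T) :=
  (Submodule.isClosed_topologicalClosure _).completeSpace_coe

theorem existsUnique_weakSolution (hn : 2 ≤ n) (T : Affine.Simplex ℝ (E n) n) (g : L2 T ℝ) :
    ∃! u : H10 T, ∀ v : H10 T, ⟪u.1.snd, v.1.snd⟫ = ⟪g, v.1.fst⟫ := by
  obtain ⟨C, hC, hP⟩ := poincare hn T
  let S : H10 T →L[ℝ] L2 T (E n) :=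
    (WithLp.sndL 2 ℝ (L2 T ℝ) (L2 T (E n))).comp (H10 T).subtypeL
  let F : H10 T →L[ℝ] L2 T ℝ :=
    (WithLp.fstL 2 ℝ (L2 T ℝ) (L2 T (E n))).comp (H10 T).subtypeL
  let B : H10 T →L[ℝ] H10 T →L[ℝ] ℝ := (innerSL ℝ).bilinearComp S S
  have hB : IsCoercive B := by
    refine ⟨(C ^ 2 + 1)⁻¹, by positivity, fun u => ?_⟩
    have h1 : ‖u‖ ^ 2 = ‖F u‖ ^ 2 + ‖S u‖ ^ 2 := WithLp.prod_norm_sq_eq_of_L2 u.1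
    have h2 : ‖F u‖ ≤ C * ‖S u‖ := hP _ u.2
    have h3 : ‖F u‖ ^ 2 ≤ C ^ 2 * ‖S u‖ ^ 2 := by
      rw [← mul_pow]; gcongr
    have h4 : B u u = ‖S u‖ ^ 2 := real_inner_self_eq_norm_sq (S u)
    rw [h4, mul_assoc, ← sq, inv_mul_le_iff₀ (by positivity), h1]
    nlinarith
  let L : H10 T →L[ℝ] ℝ := (innerSL ℝ g).comp F
  let r : H10 T := (InnerProductSpace.toDual ℝ (H10 T)).symm L
  have hr : ∀ v : H10 T, ⟪r, v⟫ = ⟪g, v.1.fst⟫ := fun v => InnerProductSpace.toDual_symm_apply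
  refine ⟨hB.continuousLinearEquivOfBilin.symm r, fun v => ?_, fun u hu => ?_⟩
  · have := hB.continuousLinearEquivOfBilin_apply (hB.continuousLinearEquivOfBilin.symm r) v
    rw [ContinuousLinearEquiv.apply_symm_apply, hr] at this
    exact this.symm
  · rw [ContinuousLinearEquiv.eq_symm_apply]
    symm
    refine hB.unique_continuousLinearEquivOfBilin fun w => ?_
    rw [hr, ← hu w]
    rfl

/-- `(-Δ)⁻¹ g ∈ H¹₀(T)`: the weak solution `v` of `-Δ v = g` in `T`, for `g ∈ L²(T)`. -/
def invLaplace (hn : 2 ≤ n) (T : Affine.Simplex ℝ (E n) n) (g : L2 T ℝ) : H10 T :=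
  (existsUnique_weakSolution hn T g).choose

/-! ### The dual norm, the eigenvalue problem and the constants -/

/-- The components of `curl q` as elements of `L²(T)`. -/
def curlL2 (T : Affine.Simplex ℝ (E n) n) (q : Fin n → Poly n) (j : Fin (2 * n - 3)) : L2 T ℝ :=
  polyL2 T (curl q j)

/-- The norm in `H⁻¹(T; ℝᵐ)`, the dual of `H¹₀(T; ℝᵐ) = H¹₀(T)ᵐ` endowed with the norm
`v ↦ ‖∇v‖`, of the functional `v ↦ ∫ v · g dx`. -/
def dualNorm (T : Affine.Simplex ℝ (E n) n) {m : ℕ} (g : Fin m → L2 T ℝ) : ℝ :=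
  sSup {x | ∃ v : Fin m → H10 T, v ≠ 0 ∧
    x = (∑ j, ⟪(v j).1.fst, g j⟫) / √(∑ j, ‖(v j).1.snd‖ ^ 2)}

/-- `Q_p`: the `L²(T; ℝⁿ)` orthogonal complement of `∇P_{p+1}(T)` in `P_p(T; ℝⁿ)`. -/
def Q (T : Affine.Simplex ℝ (E n) n) (p : ℕ) : Set (Fin n → Poly n) :=
  {q | q ∈ vecP n p ∧ ∀ v ∈ P n (p + 1), ⟪vecL2 T q, vecL2 T (grad v)⟫ = 0}

/-- The bilinear form `𝔞(q, r) = (q, r)_{L²(T)}`. -/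
def formA (T : Affine.Simplex ℝ (E n) n) (q r : Fin n → Poly n) : ℝ :=
  ⟪vecL2 T q, vecL2 T r⟫

/-- The bilinear form `𝔟(q, r) = ((-Δ)⁻¹ curl q, curl r)_{L²(T)}`, where `(-Δ)⁻¹` acts
componentwise. -/
def formB (hn : 2 ≤ n) (T : Affine.Simplex ℝ (E n) n) (q r : Fin n → Poly n) : ℝ :=
  ∑ j, ⟪(invLaplace hn T (curlL2 T q j)).1.fst, curlL2 T r j⟫

/-- The eigenvalues `λ` of the problem `𝔞(q, r) = λ 𝔟(q, r)` for all `r ∈ Q_p`. -/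
def eigenvalues (hn : 2 ≤ n) (T : Affine.Simplex ℝ (E n) n) (p : ℕ) : Set ℝ :=
  {μ | ∃ q ∈ Q T p, q ≠ 0 ∧ ∀ r ∈ Q T p, formA T q r = μ * formB hn T q r}

/-- The set of the values `‖q - ∇v‖²` for `v ∈ P_{p+1}(T)`. -/
def distSqSet (T : Affine.Simplex ℝ (E n) n) (p : ℕ) (q : Fin n → Poly n) : Set ℝ :=
  {d | ∃ v ∈ P n (p + 1), d = ‖vecL2 T (q - grad v)‖ ^ 2}

/-- The quotients `min_v ‖q - ∇v‖² / ⦀curl q⦀_*²` for `q ∈ P_p(T; ℝⁿ)` with `curl q ≠ 0`. -/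
def quotients (T : Affine.Simplex ℝ (E n) n) (p : ℕ) : Set ℝ :=
  {x | ∃ q ∈ vecP n p, curl q ≠ 0 ∧ x = sInf (distSqSet T p q) / dualNorm T (curlL2 T q) ^ 2}

/-- The number `m_p²`, the supremum of the quotients above (which is `0` if there are none). -/
def mSq (T : Affine.Simplex ℝ (E n) n) (p : ℕ) : ℝ := sSup (quotients T p)

/-- The nonnegative constants `C` with `‖∇(1 - G_{p+1}) f‖ ≤ C ‖(1 - Π_p) ∇f‖` for all
`f ∈ H¹(T)`. -/
def stabilityConstants (T : Affine.Simplex ℝ (E n) n) (p : ℕ) : Set ℝ :=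
  {C | 0 ≤ C ∧ ∀ u ∈ H1 T,
    ‖u.snd - vecL2 T (grad (galerkin T (p + 1) u))‖ ≤ C * ‖u.snd - proj T p u.snd‖}

/-- `C_{st,2}`: the best constant in the stability estimate. -/
def Cst2 (T : Affine.Simplex ℝ (E n) n) (p : ℕ) : ℝ := sInf (stabilityConstants T p)

/-- `C_2 = 1` and `C_3 = 2 / √3`. -/
def dimConst (n : ℕ) : ℝ := if n = 2 then 1 else 2 / √3

end StabConst

end

noncomputable section

namespace StabConst

variable {n : ℕ}

/-! ### Components of square integrable vector fields -/

/-! Put `s = ∇(f - G f)` and `r = Π_p ∇f - ∇(G f)`. Orthogonality of both projections gives `r ∈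
Q_p`, `s - r = (1 - Π_p)∇f`, and `r` is the `L²` projection of `s` onto `P_p`. If `r = 0`, the
estimate holds with constant 1. Otherwise every multiple `t s` is a gradient and does not change the
curl, so `|||curl r|||_* ≤ ‖r - t s‖` (`formB_self_le`), while `‖r‖² ≤ m_p² |||curl r|||_*²` by
definition of `m_p` (`formA_self_le`). The best `t` turns these two bounds into `‖s‖ ≤ m_p ‖s - r‖`
(`norm_sq_le_of_forall_le`).

The bound of the dual norm moves the curl onto a test function `w ∈ H¹₀` and needs `‖curl w‖ ≤
‖∇w‖`. For `n = 2` the two norms are equal; for `n = 3` one has `‖∇w‖² = ‖curl w‖² + ‖div w‖²` on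
`H¹₀` (`sum_norm_curl_sq_le`). Hence the sharper bound `max{1, m_p}` comes out in both dimensions,
and the factor `C_n ≥ 1` is only slack.

For the maximum: subtracting the gradient part of `q` leaves the curl unchanged and realizes the
minimum over `v`, so the quotients are the Rayleigh quotients `𝔞(q,q)/𝔟(q,q)` on `Q_p`
(`quotients_eq`), because `|||curl q|||_*² = 𝔟(q,q)` by Riesz representation (`dualNorm_curlL2_sq`).
The form `𝔟` is positive definite on `Q_p`: a curl-free polynomial field is a polynomial gradient
(`exists_grad_eq`), hence orthogonal to itself (`formB_self_pos`). In finite dimension the largest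
Rayleigh quotient is attained and is the largest eigenvalue (`isGreatest_mSq`). -/

/-- The `i`-th component of a square integrable vector field. -/
def comp (T : Affine.Simplex ℝ (E n) n) (i : Fin n) : L2 T (E n) →L[ℝ] L2 T ℝ :=
  (EuclideanSpace.proj i : E n →L[ℝ] ℝ).compLpL 2 (vol T)

theorem coeFn_comp (T : Affine.Simplex ℝ (E n) n) (i : Fin n) (a : L2 T (E n)) :
    comp T i a =ᵐ[vol T] fun x => a x i :=
  (EuclideanSpace.proj i : E n →L[ℝ] ℝ).coeFn_compLpL a

theorem inner_L2_real (T : Affine.Simplex ℝ (E n) n) (f g : L2 T ℝ) :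
    ⟪f, g⟫ = ∫ x, f x * g x ∂(vol T) := by
  rw [L2.inner_def]
  refine integral_congr_ae (Filter.Eventually.of_forall fun x => ?_)
  simp [mul_comm]

theorem inner_eq_sum_comp (T : Affine.Simplex ℝ (E n) n) (a b : L2 T (E n)) :
    ⟪a, b⟫ = ∑ i, ⟪comp T i a, comp T i b⟫ := by
  simp_rw [L2.inner_def]
  rw [← integral_finsetSum _ fun i _ => L2.integrable_inner _ _]
  refine integral_congr_ae ?_
  have h : ∀ᵐ x ∂(vol T), ∀ i, comp T i a x = a x i ∧ comp T i b x = b x i :=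
    ae_all_iff.2 fun i => (coeFn_comp T i a).and (coeFn_comp T i b)
  filter_upwards [h] with x hx
  simp only [PiLp.inner_apply]
  exact Finset.sum_congr rfl fun i _ => by rw [(hx i).1, (hx i).2]

theorem norm_sq_eq_sum_comp (T : Affine.Simplex ℝ (E n) n) (a : L2 T (E n)) :
    ‖a‖ ^ 2 = ∑ i, ‖comp T i a‖ ^ 2 := by
  simp_rw [← real_inner_self_eq_norm_sq, inner_eq_sum_comp T a a]

theorem comp_vecL2 (T : Affine.Simplex ℝ (E n) n) (q : Fin n → Poly n) (i : Fin n) :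
    comp T i (vecL2 T q) = polyL2 T (q i) := by
  refine Lp.ext ?_
  have h1 : (vecL2 T q : E n → E n) =ᵐ[vol T] evalVec q :=
    MemLp.coeFn_toLp (memLp_of_continuous T (continuous_evalVec q))
  have h2 : (polyL2 T (q i) : E n → ℝ) =ᵐ[vol T] evalFun (q i) :=
    MemLp.coeFn_toLp (memLp_of_continuous T (continuous_evalFun (q i)))
  filter_upwards [coeFn_comp T i (vecL2 T q), h1, h2] with x a b c
  rw [a, b, c]
  rfl

/-! ### Weakly differentiable functions -/

theorem gradient_apply (φ : E n → ℝ) (x : E n) (i : Fin n) :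
    gradient φ x i = fderiv ℝ φ x (EuclideanSpace.single i 1) := by
  rw [← inner_gradient_left, EuclideanSpace.inner_single_right]
  simp

theorem continuous_gradient {φ : E n → ℝ} (h : ContDiff ℝ ∞ φ) : Continuous (gradient φ) :=
  (InnerProductSpace.toDual ℝ (E n)).symm.continuous.comp (h.continuous_fderiv (by simp))

theorem contDiff_dirDeriv {φ : E n → ℝ} (h : ContDiff ℝ ∞ φ) (y : E n) :
    ContDiff ℝ ∞ fun x => fderiv ℝ φ x y :=
  (h.fderiv_right (m := ∞) (by simp)).clm_apply contDiff_const

theorem IsTest.dirDeriv {T : Affine.Simplex ℝ (E n) n} {φ : E n → ℝ} (h : IsTest T φ) (y : E n) :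
    IsTest T fun x => fderiv ℝ φ x y := by
  have hs : tsupport (fun x => fderiv ℝ φ x y) ⊆ tsupport φ :=
    closure_minimal (fun x hx => support_fderiv_subset ℝ (f := φ) fun h0 => hx (by simp [h0]))
      (isClosed_tsupport φ)
  exact ⟨contDiff_dirDeriv h.1 y, h.2.1.of_isClosed_subset (isClosed_tsupport _) hs,
    hs.trans h.2.2⟩

theorem integral_vol_eq {T : Affine.Simplex ℝ (E n) n} {f : E n → ℝ}
    (h : Function.support f ⊆ interior (body T)) : ∫ x, f x ∂(vol T) = ∫ x, f x :=
  setIntegral_eq_integral_of_forall_compl_eq_zero fun x hx => by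
    by_contra h0
    exact hx (h h0)

/-- Integration by parts on the whole space: the compact support of `φ` in the interior removes
every boundary term, so nothing is assumed of `ψ` near the boundary. -/
theorem integral_mul_gradient {T : Affine.Simplex ℝ (E n) n} {ψ φ : E n → ℝ}
    (hψ : ContDiff ℝ ∞ ψ) (hφ : IsTest T φ) (i : Fin n) :
    ∫ x, ψ x * gradient φ x i ∂(vol T) = -∫ x, gradient ψ x i * φ x ∂(vol T) := by
  simp_rw [gradient_apply]
  have hφ' := hφ.dirDeriv (EuclideanSpace.single i 1)
  have hψ' := contDiff_dirDeriv hψ (EuclideanSpace.single i 1)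
  have hs : ∀ {θ χ : E n → ℝ}, IsTest T χ → Function.support (fun x => θ x * χ x) ⊆ tsupport χ :=
    fun hχ x hx => subset_tsupport _ fun h0 => hx (by simp [h0])
  have hi : ∀ {θ χ : E n → ℝ}, ContDiff ℝ ∞ θ → IsTest T χ → Integrable fun x => θ x * χ x :=
    fun hθ hχ => (hθ.continuous.mul hχ.1.continuous).integrable_of_hasCompactSupport
      (hχ.2.1.mul_left)
  rw [integral_vol_eq ((hs hφ').trans hφ'.2.2), integral_vol_eq ((hs hφ).trans hφ.2.2)]
  exact integral_mul_fderiv_eq_neg_fderiv_mul_of_integrable (hi hψ' hφ) (hi hψ hφ') (hi hψ hφ)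
    (fun x _ => hψ.contDiffAt.differentiableAt (by simp))
    fun x _ => hφ.1.contDiffAt.differentiableAt (by simp)

/-- The pair `(φ, ∇φ)` of a smooth function. -/
def smoothPair (T : Affine.Simplex ℝ (E n) n) {φ : E n → ℝ} (h : ContDiff ℝ ∞ φ) : Pairs T :=
  WithLp.toLp 2 ((memLp_of_continuous T h.continuous).toLp φ,
    (memLp_of_continuous T (continuous_gradient h)).toLp (gradient φ))

theorem smoothPair_fst (T : Affine.Simplex ℝ (E n) n) {φ : E n → ℝ} (h : ContDiff ℝ ∞ φ) :
    (smoothPair T h).fst =ᵐ[vol T] φ :=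
  MemLp.coeFn_toLp (memLp_of_continuous T h.continuous)

theorem smoothPair_snd (T : Affine.Simplex ℝ (E n) n) {φ : E n → ℝ} (h : ContDiff ℝ ∞ φ) :
    (smoothPair T h).snd =ᵐ[vol T] gradient φ :=
  MemLp.coeFn_toLp (memLp_of_continuous T (continuous_gradient h))

theorem IsTest.smoothPair_mem {T : Affine.Simplex ℝ (E n) n} {φ : E n → ℝ} (h : IsTest T φ) :
    smoothPair T h.1 ∈ testPairs T :=
  ⟨φ, h, smoothPair_fst T h.1, smoothPair_snd T h.1⟩

/-- In this form both sides are continuous in `u` and in `v`, so the identity passes to `L²` limits;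
the defining integrals do not show this. -/
theorem mem_H1_iff {T : Affine.Simplex ℝ (E n) n} {u : Pairs T} :
    u ∈ H1 T ↔ ∀ v ∈ testPairs T, ∀ i, ⟪u.fst, comp T i v.snd⟫ = -⟪comp T i u.snd, v.fst⟫ := by
  have key : ∀ (φ : E n → ℝ) (v : Pairs T), v.fst =ᵐ[vol T] φ → v.snd =ᵐ[vol T] gradient φ →
      ∀ i, ⟪u.fst, comp T i v.snd⟫ = ∫ x, u.fst x * gradient φ x i ∂(vol T) ∧
        ⟪comp T i u.snd, v.fst⟫ = ∫ x, u.snd x i * φ x ∂(vol T) := by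
    intro φ v h1 h2 i
    rw [inner_L2_real, inner_L2_real]
    constructor
    · refine integral_congr_ae ?_
      filter_upwards [coeFn_comp T i v.snd, h2] with x a b
      simp only [a, b]
    · refine integral_congr_ae ?_
      filter_upwards [coeFn_comp T i u.snd, h1] with x a b
      simp only [a, b]
  constructor
  · rintro h v ⟨φ, hφ, h1, h2⟩ i
    rw [(key φ v h1 h2 i).1, (key φ v h1 h2 i).2]
    exact h φ hφ i
  · intro h φ hφ i
    have := key φ _ (smoothPair_fst T hφ.1) (smoothPair_snd T hφ.1) i
    rw [← this.1, ← this.2]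
    exact h _ hφ.smoothPair_mem i

/-- Equalities of continuous functions extend from test functions to `H¹₀(T)`. -/
theorem H10_induction {T : Affine.Simplex ℝ (E n) n} {F G : Pairs T → ℝ} (hF : Continuous F)
    (hG : Continuous G) (h : ∀ v ∈ testPairs T, F v = G v) {v : Pairs T} (hv : v ∈ H10 T) :
    F v = G v :=
  closure_minimal (s := (testPairs T : Set (Pairs T))) h (isClosed_eq hF hG) hv

theorem inner_comp_snd_of_mem_H1 {T : Affine.Simplex ℝ (E n) n} {u v : Pairs T} (hu : u ∈ H1 T)
    (hv : v ∈ H10 T) (i : Fin n) : ⟪u.fst, comp T i v.snd⟫ = -⟪comp T i u.snd, v.fst⟫ :=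
  H10_induction (F := fun v => ⟪u.fst, comp T i v.snd⟫) (by fun_prop) (by fun_prop)
    (fun v hv => mem_H1_iff.1 hu v hv i) hv

theorem mem_H1_of_smooth {T : Affine.Simplex ℝ (E n) n} {ψ : E n → ℝ} (hψ : ContDiff ℝ ∞ ψ)
    {u : Pairs T} (h1 : u.fst =ᵐ[vol T] ψ) (h2 : u.snd =ᵐ[vol T] gradient ψ) : u ∈ H1 T := by
  intro φ hφ i
  have e1 : ∫ x, u.fst x * gradient φ x i ∂(vol T) = ∫ x, ψ x * gradient φ x i ∂(vol T) := by
    refine integral_congr_ae ?_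
    filter_upwards [h1] with x a
    rw [a]
  have e2 : ∫ x, u.snd x i * φ x ∂(vol T) = ∫ x, gradient ψ x i * φ x ∂(vol T) := by
    refine integral_congr_ae ?_
    filter_upwards [h2] with x a
    rw [a]
  rw [e1, e2, integral_mul_gradient hψ hφ]

theorem H10_subset_H1 {T : Affine.Simplex ℝ (E n) n} {u : Pairs T} (hu : u ∈ H10 T) :
    u ∈ H1 T :=
  mem_H1_iff.2 fun v hv i => H10_induction
    (F := fun u => ⟪u.fst, comp T i v.snd⟫) (G := fun u => -⟪comp T i u.snd, v.fst⟫)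
    (by fun_prop) (by fun_prop)
    (fun _ ⟨_, hφ, h1, h2⟩ => mem_H1_iff.1 (mem_H1_of_smooth hφ.1 h1 h2) v hv i) hu

theorem H1_sub {T : Affine.Simplex ℝ (E n) n} {u v : Pairs T} (hu : u ∈ H1 T) (hv : v ∈ H1 T) :
    u - v ∈ H1 T := by
  rw [mem_H1_iff] at *
  intro w hw i
  simp only [WithLp.sub_fst, WithLp.sub_snd, map_sub, inner_sub_left, hu w hw i, hv w hw i]
  ring

theorem H1_smul {T : Affine.Simplex ℝ (E n) n} {u : Pairs T} (hu : u ∈ H1 T) (c : ℝ) :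
    c • u ∈ H1 T := by
  rw [mem_H1_iff] at *
  intro w hw i
  simp only [WithLp.smul_fst, WithLp.smul_snd, map_smul, real_inner_smul_left, hu w hw i]
  ring

/-- The derivatives `∂ᵢu` and `∂ₖu` of a weakly differentiable function have the same mixed
second derivative. -/
theorem inner_comp_comp_comm {T : Affine.Simplex ℝ (E n) n} {u v : Pairs T} (hu : u ∈ H1 T)
    (hv : v ∈ H10 T) (i k : Fin n) :
    ⟪comp T i u.snd, comp T k v.snd⟫ = ⟪comp T k u.snd, comp T i v.snd⟫ := by
  refine H10_induction (F := fun v => ⟪comp T i u.snd, comp T k v.snd⟫)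
    (G := fun v => ⟪comp T k u.snd, comp T i v.snd⟫) (by fun_prop) (by fun_prop) ?_ hv
  rintro v ⟨φ, hφ, -, h2⟩
  -- Integrating by parts once more, against the test function `∂ₖφ`, puts both derivatives on `φ`,
  -- where they commute.
  have key : ∀ i k : Fin n, ⟪comp T i u.snd, comp T k v.snd⟫ = -∫ x, u.fst x *
      fderiv ℝ (fderiv ℝ φ) x (EuclideanSpace.single i 1) (EuclideanSpace.single k 1)
        ∂(vol T) := by
    intro i k
    have h := hu _ (hφ.dirDeriv (EuclideanSpace.single k 1)) i
    have e1 : ⟪comp T i u.snd, comp T k v.snd⟫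
        = ∫ x, u.snd x i * fderiv ℝ φ x (EuclideanSpace.single k 1) ∂(vol T) := by
      rw [inner_L2_real]
      refine integral_congr_ae ?_
      filter_upwards [coeFn_comp T i u.snd, coeFn_comp T k v.snd, h2] with x a b c
      rw [a, b, c, gradient_apply]
    rw [e1, ← neg_eq_iff_eq_neg.2 h]
    congr 1
    refine integral_congr_ae (Filter.Eventually.of_forall fun x => ?_)
    have hd : DifferentiableAt ℝ (fderiv ℝ φ) x :=
      (hφ.1.fderiv_right (m := ∞) (by simp)).contDiffAt.differentiableAt (by simp)
    simp only [gradient_apply]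
    rw [fderiv_clm_apply hd (differentiableAt_const _)]
    simp
  rw [key, key]
  congr 1
  refine integral_congr_ae (Filter.Eventually.of_forall fun x => ?_)
  have hsymm : IsSymmSndFDerivAt ℝ φ x :=
    hφ.1.contDiffAt.isSymmSndFDerivAt
    (by rw [minSmoothness_of_isRCLikeNormedField]; exact WithTop.coe_le_coe.2 le_top)
  simp only [hsymm _ _]

/-! ### Polynomials as weakly differentiable functions -/

theorem contDiff_evalFun (v : Poly n) : ContDiff ℝ ∞ (evalFun v) := by
  induction v using MvPolynomial.induction_on with
  | C c =>
    have e : evalFun (MvPolynomial.C c : Poly n) = fun _ => c := by ext x; simp [evalFun]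
    rw [e]
    exact contDiff_const
  | add v w hv hw =>
    have e : evalFun (v + w) = fun x => evalFun v x + evalFun w x := by ext x; simp [evalFun]
    rw [e]
    exact hv.add hw
  | mul_X v i hv =>
    have e : evalFun (v * MvPolynomial.X i) = fun x => evalFun v x * x i := by
      ext x; simp [evalFun]
    rw [e]
    exact hv.mul (by fun_prop)

theorem fderiv_evalFun (v : Poly n) (x : E n) (i : Fin n) :
    fderiv ℝ (evalFun v) x (EuclideanSpace.single i 1) = evalFun (MvPolynomial.pderiv i v) x := by
  have hd : ∀ v : Poly n, DifferentiableAt ℝ (evalFun v) x := fun v =>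
    (contDiff_evalFun v).contDiffAt.differentiableAt (by simp)
  induction v using MvPolynomial.induction_on with
  | C c =>
    have e : evalFun (MvPolynomial.C c : Poly n) = fun _ => c := by ext x; simp [evalFun]
    rw [e]
    simp [evalFun]
  | add v w hv hw =>
    have e : evalFun (v + w) = evalFun v + evalFun w := by ext x; simp [evalFun]
    rw [e, fderiv_add (hd v) (hd w)]
    simp [hv, hw, evalFun]
  | mul_X v j hv =>
    have e : evalFun (v * MvPolynomial.X j) =
        fun x => evalFun v x * evalFun (MvPolynomial.X j) x := by
      ext x; simp [evalFun]
    have e2 : evalFun (MvPolynomial.X j : Poly n) = EuclideanSpace.proj (𝕜 := ℝ) j := by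
      ext x; simp [evalFun]
    rw [e, fderiv_fun_mul (hd v) (hd _)]
    have e3 : fderiv ℝ (evalFun (MvPolynomial.X j : Poly n)) x =
        EuclideanSpace.proj (𝕜 := ℝ) j := by
      rw [e2]
      exact ContinuousLinearMap.fderiv _
    simp only [add_apply, smul_apply, hv, e3]
    rcases eq_or_ne i j with rfl | hij
    · simp [evalFun]
    · simp [evalFun, MvPolynomial.pderiv_X_of_ne hij.symm, hij]

/-- The pair `(v, ∇v)` of a polynomial `v`. -/
def polyPair (T : Affine.Simplex ℝ (E n) n) (v : Poly n) : Pairs T :=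
  WithLp.toLp 2 (polyL2 T v, vecL2 T (grad v))

theorem polyPair_mem_H1 (T : Affine.Simplex ℝ (E n) n) (v : Poly n) : polyPair T v ∈ H1 T := by
  refine mem_H1_of_smooth (contDiff_evalFun v)
    (MemLp.coeFn_toLp (memLp_of_continuous T (continuous_evalFun v)))
    ((MemLp.coeFn_toLp (memLp_of_continuous T (continuous_evalVec (grad v)))).trans
      (Filter.Eventually.of_forall fun x => ?_))
  ext i
  rw [gradient_apply, fderiv_evalFun]
  rfl

theorem inner_fst_pderiv {T : Affine.Simplex ℝ (E n) n} {w : Pairs T} (hw : w ∈ H10 T)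
    (v : Poly n) (i : Fin n) :
    ⟪w.fst, polyL2 T (MvPolynomial.pderiv i v)⟫ = -⟪comp T i w.snd, polyL2 T v⟫ := by
  have h := inner_comp_snd_of_mem_H1 (polyPair_mem_H1 T v) hw i
  have h1 : comp T i (polyPair T v).snd = polyL2 T (MvPolynomial.pderiv i v) :=
    comp_vecL2 T (grad v) i
  have h2 : (polyPair T v).fst = polyL2 T v := rfl
  rw [h1, h2] at h
  rw [real_inner_comm, ← neg_eq_iff_eq_neg.2 h, real_inner_comm]

/-! ### The curl -/

theorem sum_inner_le_sqrt_mul_sqrt {ι V : Type*} [Fintype ι] [NormedAddCommGroup V]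
    [InnerProductSpace ℝ V] (c e : ι → V) :
    ∑ i, ⟪c i, e i⟫ ≤ √(∑ i, ‖c i‖ ^ 2) * √(∑ i, ‖e i‖ ^ 2) :=
  (Finset.sum_le_sum fun i _ => real_inner_le_norm (c i) (e i)).trans
    (Real.sum_mul_le_sqrt_mul_sqrt _ _ _)

/-- With `d i j = ∂ᵢwⱼ`, the hypothesis turns `⟪∂ᵢwᵢ, ∂ₖwₖ⟫` into `⟪∂ₖwᵢ, ∂ᵢwₖ⟫`, so the cross terms
of `‖div w‖²` and `‖curl w‖²` cancel. The two sides differ by exactly `‖div w‖²`. -/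
theorem sum_norm_curl_sq_le {V : Type*} [NormedAddCommGroup V] [InnerProductSpace ℝ V]
    (d : Fin 3 → Fin 3 → V) (h : ∀ i k j l, ⟪d i j, d k l⟫ = ⟪d k j, d i l⟫) :
    ‖d 1 2 - d 2 1‖ ^ 2 + ‖d 2 0 - d 0 2‖ ^ 2 + ‖d 0 1 - d 1 0‖ ^ 2 ≤
      ∑ j, ∑ i, ‖d i j‖ ^ 2 := by
  have hdiv := sq_nonneg ‖d 0 0 + d 1 1 + d 2 2‖
  rw [norm_add_sq_real, norm_add_sq_real, inner_add_left, h 0 1 0 1, h 0 2 0 2, h 1 2 1 2] at hdiv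
  simp only [Fin.sum_univ_three, norm_sub_sq_real]
  rw [real_inner_comm (d 2 1) (d 1 2), real_inner_comm (d 1 0) (d 0 1)]
  linarith

/-- The dual norm of the curl of `r` is at most the distance of `r` to gradient fields, as the
norm of the curl is at most the norm of the gradient in `H¹₀(T)`. -/
theorem sum_inner_curl_le (hn : 2 ≤ n) (hn' : n ≤ 3) {T : Affine.Simplex ℝ (E n) n}
    {u : Pairs T} (hu : u ∈ H1 T) (r : Fin n → Poly n) (w : Fin (2 * n - 3) → H10 T) :
    ∑ j, ⟪(w j).1.fst, curlL2 T r j⟫ ≤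
      √(∑ j, ‖(w j).1.snd‖ ^ 2) * ‖vecL2 T r - u.snd‖ := by
  -- The gradient `u.snd` may be subtracted for free, since its contributions cancel by the symmetry
  -- of mixed derivatives.
  have hsum : ∀ i k : Fin n, ∀ j, ⟪(w j).1.fst, polyL2 T
      (MvPolynomial.pderiv i (r k) - MvPolynomial.pderiv k (r i))⟫ =
      ⟪comp T k (w j).1.snd, comp T i (vecL2 T r - u.snd)⟫
        - ⟪comp T i (w j).1.snd, comp T k (vecL2 T r - u.snd)⟫ := by
    intro i k j
    rw [map_sub, inner_sub_right, inner_fst_pderiv (w j).2, inner_fst_pderiv (w j).2, map_sub,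
      map_sub, comp_vecL2, comp_vecL2, inner_sub_right, inner_sub_right,
      real_inner_comm (comp T k u.snd), real_inner_comm (comp T i u.snd),
      inner_comp_comp_comm hu (w j).2 k i]
    ring
  -- Cauchy–Schwarz reduces the claim to finding the field `c`, the formal adjoint of the curl
  -- applied to `w`, with norm at most that of `∇w`.
  have hfin : ∀ c : Fin n → L2 T ℝ, ∑ i, ‖c i‖ ^ 2 ≤ ∑ j, ‖(w j).1.snd‖ ^ 2 →
      ∑ j, ⟪(w j).1.fst, curlL2 T r j⟫ = ∑ i, ⟪c i, comp T i (vecL2 T r - u.snd)⟫ →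
      ∑ j, ⟪(w j).1.fst, curlL2 T r j⟫ ≤
        √(∑ j, ‖(w j).1.snd‖ ^ 2) * ‖vecL2 T r - u.snd‖ := by
    intro c hc h
    rw [h, ← Real.sqrt_sq (norm_nonneg (vecL2 T r - u.snd)), norm_sq_eq_sum_comp]
    exact (sum_inner_le_sqrt_mul_sqrt _ _).trans (by gcongr)
  have hfin' : ∀ c : Fin n → L2 T ℝ, ∑ i, ‖c i‖ ^ 2 ≤
        ∑ j, ∑ i, ‖comp T i (w j).1.snd‖ ^ 2 →
      ∑ j, ⟪(w j).1.fst, curlL2 T r j⟫ = ∑ i, ⟪c i, comp T i (vecL2 T r - u.snd)⟫ →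
      ∑ j, ⟪(w j).1.fst, curlL2 T r j⟫ ≤
        √(∑ j, ‖(w j).1.snd‖ ^ 2) * ‖vecL2 T r - u.snd‖ := fun c hc =>
    hfin c (hc.trans_eq (Finset.sum_congr rfl fun j _ => (norm_sq_eq_sum_comp T _).symm))
  have hc : ∀ i k j l, ⟪comp T i (w j).1.snd, comp T k (w l).1.snd⟫ =
        ⟪comp T k (w j).1.snd, comp T i (w l).1.snd⟫ := fun i k j l =>
    inner_comp_comp_comm (H10_subset_H1 (w j).2) (w l).2 i k
  generalize hd : (fun i j => comp T i (w j).1.snd) = d at *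
  generalize he : (fun i => comp T i (vecL2 T r - u.snd)) = e at *
  simp only [funext_iff] at hd he
  simp only [hd, he] at hfin' hsum hc
  clear hfin
  obtain rfl | rfl : n = 2 ∨ n = 3 := by omega
  -- For `n = 2`, `c = (∂₂w, -∂₁w)` is a rotated gradient of the same norm.
  · refine hfin' ![d 1 0, -d 0 0] ?_ ?_
    · change _ ≤ ∑ j : Fin 1, _
      simp only [Fin.sum_univ_two, Fin.sum_univ_one, Matrix.cons_val_zero, Matrix.cons_val_one,
        norm_neg]
      exact (add_comm _ _).le
    · have h0 := hsum 0 1 0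
      change ∑ j : Fin 1, _ = _
      rw [Fin.sum_univ_one, Fin.sum_univ_two]
      refine h0.trans ?_
      simp only [Matrix.cons_val_zero, Matrix.cons_val_one, inner_neg_left, sub_eq_add_neg]
  · refine hfin' ![d 1 2 - d 2 1, d 2 0 - d 0 2, d 0 1 - d 1 0] ?_ ?_
    · refine le_trans (le_of_eq ?_) (sum_norm_curl_sq_le d hc)
      simp only [Fin.sum_univ_three, Matrix.cons_val_zero, Matrix.cons_val_one, Matrix.cons_val]
    · have h0 := hsum 1 2 0
      have h1 := hsum 2 0 1
      have h2 := hsum 0 1 2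
      change ∑ j : Fin 3, _ = _
      rw [Fin.sum_univ_three, Fin.sum_univ_three]
      refine (congrArg₂ (· + ·) (congrArg₂ (· + ·) h0 h1) h2).trans ?_
      simp only [inner_sub_left, Matrix.cons_val_zero, Matrix.cons_val_one, Matrix.cons_val]
      ring

/-! ### Curl-free polynomial vector fields -/

theorem pderiv_homogeneousComponent_succ (f : Poly n) (i : Fin n) (k : ℕ) :
    MvPolynomial.pderiv i (MvPolynomial.homogeneousComponent (k + 1) f) =
      MvPolynomial.homogeneousComponent k (MvPolynomial.pderiv i f) := by
  ext m
  have h : (m + Finsupp.single i 1).degree = k + 1 ↔ m.degree = k := by simp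
  simp only [MvPolynomial.coeff_pderiv, MvPolynomial.coeff_homogeneousComponent, h]
  split_ifs <;> simp

theorem sum_homogeneousComponent_of_mem {p : ℕ} {f : Poly n} (hf : f ∈ P n p) :
    ∑ k ∈ Finset.range (p + 1), MvPolynomial.homogeneousComponent k f = f := by
  rw [MvPolynomial.mem_restrictTotalDegree] at hf
  conv_rhs => rw [← MvPolynomial.sum_homogeneousComponent f]
  symm
  refine Finset.sum_subset (Finset.range_mono (by omega)) fun k _ hk => ?_
  exact MvPolynomial.homogeneousComponent_eq_zero _ _ (by simpa using hk)

/-- The Poincaré lemma for polynomial vector fields. -/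
theorem exists_grad_eq {p : ℕ} {q : Fin n → Poly n} (hq : q ∈ vecP n p)
    (h : ∀ i j, MvPolynomial.pderiv i (q j) = MvPolynomial.pderiv j (q i)) :
    ∃ v ∈ P n (p + 1), grad v = q := by
  have hq' : ∀ i, q i ∈ P n p := fun i => hq i (Set.mem_univ i)
  let c : ℕ → Fin n → Poly n := fun k i => MvPolynomial.homogeneousComponent k (q i)
  have hc : ∀ k i j, MvPolynomial.pderiv i (c k j) = MvPolynomial.pderiv j (c k i) := by
    rintro (_ | k) i j
    · simp [c, MvPolynomial.homogeneousComponent_zero]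
    · simp only [c, pderiv_homogeneousComponent_succ, h i j]
  have hhom : ∀ k i, (c k i).IsHomogeneous k := fun k i =>
    MvPolynomial.homogeneousComponent_isHomogeneous k (q i)
  -- Homotopy formula in each degree `k`: as `c k` is curl-free, `∂ⱼ ∑ xᵢcᵢ = cⱼ + ∑ xᵢ∂ᵢcⱼ`, which
  -- is `(k + 1) cⱼ` by Euler's identity.
  refine ⟨∑ k ∈ Finset.range (p + 1), ((k : ℝ) + 1)⁻¹ • ∑ i, MvPolynomial.X i * c k i, ?_, ?_⟩
  · refine Submodule.sum_mem _ fun k hk => Submodule.smul_mem _ _ (Submodule.sum_mem _ fun i _ => ?_)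
    rw [MvPolynomial.mem_restrictTotalDegree, add_comm p 1]
    have hk' : k ≤ p := by simpa [Nat.lt_succ_iff] using hk
    refine (MvPolynomial.totalDegree_mul _ _).trans (add_le_add (by simp) ?_)
    exact (hhom k i).totalDegree_le.trans hk'
  · ext1 j
    change MvPolynomial.pderiv j _ = q j
    rw [map_sum, ← sum_homogeneousComponent_of_mem (hq' j)]
    refine Finset.sum_congr rfl fun k _ => ?_
    have hsum : MvPolynomial.pderiv j (∑ i, MvPolynomial.X i * c k i) = ((k : ℝ) + 1) • c k j := by
      rw [map_sum]
      simp only [Derivation.leibniz, hc k j, smul_eq_mul, Finset.sum_add_distrib,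
        (hhom k j).sum_X_mul_pderiv]
      have h1 : ∑ i, c k i * MvPolynomial.pderiv j (MvPolynomial.X i) = c k j := by
        rw [Finset.sum_eq_single j]
        · simp
        · intro i _ hij
          rw [MvPolynomial.pderiv_X_of_ne hij, mul_zero]
        · simp
      rw [h1, add_smul, one_smul, Nat.cast_smul_eq_nsmul]
    rw [Derivation.map_smul, hsum, smul_smul, inv_mul_cancel₀ (by positivity), one_smul]

theorem grad_mem_vecP {p : ℕ} {v : Poly n} (hv : v ∈ P n (p + 1)) : grad v ∈ vecP n p := by
  intro i _
  rw [MvPolynomial.mem_restrictTotalDegree] at hv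
  change MvPolynomial.pderiv i v ∈ P n p
  rw [MvPolynomial.mem_restrictTotalDegree]
  refine Finset.sup_le fun m hm => ?_
  rw [MvPolynomial.mem_support_iff, MvPolynomial.coeff_pderiv] at hm
  have h := (MvPolynomial.le_totalDegree
    (MvPolynomial.mem_support_iff.2 (left_ne_zero_of_mul hm))).trans hv
  rw [Finsupp.sum_add_index' (fun _ => rfl) fun _ _ _ => rfl,
    Finsupp.sum_single_index rfl] at h
  omega

theorem curl_add (q r : Fin n → Poly n) : curl (q + r) = curl q + curl r := by
  match n, q, r with
  | 0, _, _ => simp [curl]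
  | 1, _, _ => simp [curl]
  | 2, q, r => ext1 j; simp [curl]; ring
  | 3, q, r =>
    change _ = (_ : Fin 3 → Poly 3)
    ext1 j; fin_cases j <;> simp [curl] <;> ring
  | _ + 4, _, _ => simp [curl]

theorem curl_smul (c : ℝ) (q : Fin n → Poly n) : curl (c • q) = c • curl q := by
  match n, q with
  | 0, _ => exact (smul_zero c).symm
  | 1, _ => exact (smul_zero c).symm
  | 2, q => ext1 j; simp [curl, smul_sub]
  | 3, q =>
    change _ = (_ : Fin 3 → Poly 3)
    ext1 j; fin_cases j <;> simp [curl, smul_sub]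
  | _ + 4, _ => simp [curl]

theorem pderiv_comm (i j : Fin n) (v : Poly n) :
    MvPolynomial.pderiv i (MvPolynomial.pderiv j v) =
      MvPolynomial.pderiv j (MvPolynomial.pderiv i v) := by
  let D : Fin n → Derivation ℝ (Poly n) (Poly n) := MvPolynomial.pderiv
  -- The commutator is a derivation, so it suffices that it vanishes on the variables.
  have h : ⁅D i, D j⁆ = 0 := MvPolynomial.derivation_ext fun k => by
    simp [D, Derivation.commutator_apply, MvPolynomial.pderiv_X, Pi.single_apply, apply_ite]
  have := DFunLike.congr_fun h v
  rwa [Derivation.commutator_apply, Derivation.zero_apply, sub_eq_zero] at this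

theorem curl_grad (v : Poly n) : curl (grad v) = 0 := by
  match n, v with
  | 0, _ => simp [curl]
  | 1, _ => simp [curl]
  | 2, v => ext1 j; simp [curl, grad, pderiv_comm 0 1]
  | 3, v =>
    change _ = (_ : Fin 3 → Poly 3)
    ext1 j; fin_cases j <;> simp [curl, grad, pderiv_comm 0 1, pderiv_comm 0 2, pderiv_comm 1 2]
  | _ + 4, _ => simp [curl]

theorem pderiv_eq_of_curl_eq_zero (hn : 2 ≤ n) (hn' : n ≤ 3) {q : Fin n → Poly n}
    (h : curl q = 0) (i j : Fin n) :
    MvPolynomial.pderiv i (q j) = MvPolynomial.pderiv j (q i) := by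
  obtain rfl | rfl : n = 2 ∨ n = 3 := by omega
  · have h0 : MvPolynomial.pderiv 0 (q 1) - MvPolynomial.pderiv 1 (q 0) = 0 := congrFun h 0
    have h0' := sub_eq_zero.1 h0
    fin_cases i <;> fin_cases j <;> simp [h0']
  · have h0 : MvPolynomial.pderiv 1 (q 2) - MvPolynomial.pderiv 2 (q 1) = 0 := congrFun h 0
    have h1 : MvPolynomial.pderiv 2 (q 0) - MvPolynomial.pderiv 0 (q 2) = 0 := congrFun h 1
    have h2 : MvPolynomial.pderiv 0 (q 1) - MvPolynomial.pderiv 1 (q 0) = 0 := congrFun h 2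
    have h0' := sub_eq_zero.1 h0
    have h1' := sub_eq_zero.1 h1
    have h2' := sub_eq_zero.1 h2
    fin_cases i <;> fin_cases j <;> simp [h0', h1', h2']

/-- The rotation field `-x₂ e₁ + x₁ e₂` has a nonzero curl. -/
theorem exists_curl_ne_zero (hn : 2 ≤ n) (hn' : n ≤ 3) {p : ℕ} (hp : 1 ≤ p) :
    ∃ q ∈ vecP n p, curl q ≠ 0 := by
  -- The witness is the shear `x₁e₂`, with `∂₁q₂ = 1` and `∂₂q₁ = 0`; its degree 1 is where `1 ≤ p`
  -- enters.
  refine ⟨Pi.single ⟨1, by omega⟩ (MvPolynomial.X ⟨0, by omega⟩), fun i _ => ?_, fun h => ?_⟩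
  · change _ ∈ P n p
    rw [MvPolynomial.mem_restrictTotalDegree]
    rcases eq_or_ne i ⟨1, by omega⟩ with rfl | hi
    · simpa using hp
    · simp [hi]
  · have := pderiv_eq_of_curl_eq_zero hn hn' h ⟨0, by omega⟩ ⟨1, by omega⟩
    simp at this

/-! ### The bilinear forms and the dual norm -/

theorem inner_invLaplace (hn : 2 ≤ n) (T : Affine.Simplex ℝ (E n) n) (g : L2 T ℝ) (v : H10 T) :
    ⟪(invLaplace hn T g).1.snd, v.1.snd⟫ = ⟪g, v.1.fst⟫ :=
  (existsUnique_weakSolution hn T g).choose_spec.1 v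

theorem formB_eq (hn : 2 ≤ n) (T : Affine.Simplex ℝ (E n) n) (q r : Fin n → Poly n) :
    formB hn T q r = ∑ j, ⟪(invLaplace hn T (curlL2 T q j)).1.snd,
      (invLaplace hn T (curlL2 T r j)).1.snd⟫ := by
  refine Finset.sum_congr rfl fun j _ => ?_
  rw [real_inner_comm, ← inner_invLaplace hn, real_inner_comm]

theorem formB_self (hn : 2 ≤ n) (T : Affine.Simplex ℝ (E n) n) (q : Fin n → Poly n) :
    formB hn T q q = ∑ j, ‖(invLaplace hn T (curlL2 T q j)).1.snd‖ ^ 2 := by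
  simp_rw [formB_eq, real_inner_self_eq_norm_sq]

theorem formB_comm (hn : 2 ≤ n) (T : Affine.Simplex ℝ (E n) n) (q r : Fin n → Poly n) :
    formB hn T q r = formB hn T r q := by
  simp_rw [formB_eq, real_inner_comm]

theorem formB_self_nonneg (hn : 2 ≤ n) (T : Affine.Simplex ℝ (E n) n) (q : Fin n → Poly n) :
    0 ≤ formB hn T q q := by
  rw [formB_self]
  positivity

theorem curlL2_add (T : Affine.Simplex ℝ (E n) n) (q r : Fin n → Poly n) (j : Fin (2 * n - 3)) :
    curlL2 T (q + r) j = curlL2 T q j + curlL2 T r j := by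
  rw [curlL2, curl_add, Pi.add_apply, map_add, curlL2, curlL2]

theorem curlL2_smul (T : Affine.Simplex ℝ (E n) n) (c : ℝ) (q : Fin n → Poly n)
    (j : Fin (2 * n - 3)) : curlL2 T (c • q) j = c • curlL2 T q j := by
  rw [curlL2, curl_smul, Pi.smul_apply, map_smul, curlL2]

theorem formB_add_right (hn : 2 ≤ n) (T : Affine.Simplex ℝ (E n) n) (q r s : Fin n → Poly n) :
    formB hn T q (r + s) = formB hn T q r + formB hn T q s := by
  simp only [formB, curlL2_add, inner_add_right, Finset.sum_add_distrib]

theorem formB_smul_right (hn : 2 ≤ n) (T : Affine.Simplex ℝ (E n) n) (c : ℝ)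
    (q r : Fin n → Poly n) : formB hn T q (c • r) = c * formB hn T q r := by
  simp only [formB, curlL2_smul, real_inner_smul_right, Finset.mul_sum]

/-- `𝔟` as a bilinear map. -/
def bilinB (hn : 2 ≤ n) (T : Affine.Simplex ℝ (E n) n) :
    (Fin n → Poly n) →ₗ[ℝ] (Fin n → Poly n) →ₗ[ℝ] ℝ :=
  LinearMap.mk₂ ℝ (formB hn T)
    (fun q r s => by
      rw [formB_comm, formB_add_right, formB_comm hn T s, formB_comm hn T s])
    (fun c q r => by
      rw [formB_comm, formB_smul_right, formB_comm hn T r, smul_eq_mul])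
    (formB_add_right hn T) fun c q r => formB_smul_right hn T c q r

/-- `𝔞` as a bilinear map. -/
def bilinA (T : Affine.Simplex ℝ (E n) n) : (Fin n → Poly n) →ₗ[ℝ] (Fin n → Poly n) →ₗ[ℝ] ℝ :=
  LinearMap.mk₂ ℝ (formA T)
    (fun q r s => by rw [formA, map_add, inner_add_left, formA, formA])
    (fun c q r => by rw [formA, map_smul, real_inner_smul_left, formA, smul_eq_mul])
    (fun q r s => by rw [formA, map_add, inner_add_right, formA, formA])
    fun c q r => by rw [formA, map_smul, real_inner_smul_right, formA, smul_eq_mul]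

theorem formA_comm (T : Affine.Simplex ℝ (E n) n) (q r : Fin n → Poly n) :
    formA T q r = formA T r q := real_inner_comm _ _

theorem formA_self (T : Affine.Simplex ℝ (E n) n) (q : Fin n → Poly n) :
    formA T q q = ‖vecL2 T q‖ ^ 2 := real_inner_self_eq_norm_sq _

/-- In the inner product `(∇·, ∇·)` the functional `curl q` is represented by `w = (-Δ)⁻¹ curl q`,
so the supremum is `‖∇w‖`, attained at `w` if `w ≠ 0`. -/
theorem dualNorm_curlL2_sq (hn : 2 ≤ n) (T : Affine.Simplex ℝ (E n) n) (q : Fin n → Poly n) :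
    dualNorm T (curlL2 T q) ^ 2 = formB hn T q q := by
  set w : Fin (2 * n - 3) → H10 T := fun j => invLaplace hn T (curlL2 T q j) with hw
  have hin : ∀ v : Fin (2 * n - 3) → H10 T,
      ∑ j, ⟪(v j).1.fst, curlL2 T q j⟫ = ∑ j, ⟪(w j).1.snd, (v j).1.snd⟫ := fun v =>
    Finset.sum_congr rfl fun j _ => by rw [hw, inner_invLaplace, real_inner_comm]
  have hself : ∑ j, ⟪(w j).1.snd, (w j).1.snd⟫ = ∑ j, ‖(w j).1.snd‖ ^ 2 :=
    Finset.sum_congr rfl fun j _ => real_inner_self_eq_norm_sq _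
  have hle : ∀ v : Fin (2 * n - 3) → H10 T,
      (∑ j, ⟪(v j).1.fst, curlL2 T q j⟫) / √(∑ j, ‖(v j).1.snd‖ ^ 2)
        ≤ √(∑ j, ‖(w j).1.snd‖ ^ 2) := fun v =>
    div_le_of_le_mul₀ (Real.sqrt_nonneg _) (Real.sqrt_nonneg _) <| by
      rw [hin]
      exact sum_inner_le_sqrt_mul_sqrt _ _
  have key : dualNorm T (curlL2 T q) = √(∑ j, ‖(w j).1.snd‖ ^ 2) := by
    refine le_antisymm (Real.sSup_le ?_ (Real.sqrt_nonneg _)) ?_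
    · rintro _ ⟨v, -, rfl⟩
      exact hle v
    · by_cases h0 : w = 0
      · have : √(∑ j, ‖(w j).1.snd‖ ^ 2) = 0 := by simp [h0]
        rw [this]
        refine Real.sSup_nonneg ?_
        rintro _ ⟨v, -, rfl⟩
        rw [hin, h0]
        simp
      · refine le_csSup ⟨√(∑ j, ‖(w j).1.snd‖ ^ 2), ?_⟩ ⟨w, h0, ?_⟩
        · rintro _ ⟨v, -, rfl⟩
          exact hle v
        · rw [hin, hself, Real.div_sqrt]
  rw [key, Real.sq_sqrt (by positivity), formB_self]

/-- Fundamental lemma of the calculus of variations, with continuity upgrading "almost everywhere"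
to "everywhere". -/
theorem eq_zero_of_inner_H10_eq_zero (T : Affine.Simplex ℝ (E n) n) {v : Poly n}
    (h : ∀ w : H10 T, ⟪polyL2 T v, w.1.fst⟫ = 0) : v = 0 := by
  refine eq_zero_of_evalFun_eq_zero T v fun x hx => ?_
  have hae := isOpen_interior.ae_eq_zero_of_integral_contDiff_smul_eq_zero
    (U := interior (body T)) (μ := (volume : Measure (E n)))
    ((continuous_evalFun v).locallyIntegrable.locallyIntegrableOn _) fun φ h1 h2 h3 => by
      have hφ : IsTest T φ := ⟨h1, h2, h3⟩
      have h0 := h ⟨smoothPair T h1, Submodule.le_topologicalClosure _ hφ.smoothPair_mem⟩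
      rw [inner_L2_real] at h0
      rw [← integral_vol_eq (T := T), ← h0]
      · have hv : (polyL2 T v : E n → ℝ) =ᵐ[vol T] evalFun v :=
          MemLp.coeFn_toLp (memLp_of_continuous T (continuous_evalFun v))
        refine integral_congr_ae ?_
        filter_upwards [hv, smoothPair_fst T h1] with x a b
        simp only [a, b, smul_eq_mul, mul_comm]
      · exact fun x hx => h3 (subset_tsupport _ fun h0 => hx (by simp [h0]))
  exact Measure.eqOn_open_of_ae_eq (g := fun _ => 0)
    ((ae_restrict_iff' isOpen_interior.measurableSet).2 hae)
    isOpen_interior (continuous_evalFun v).continuousOn continuousOn_const hx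

theorem curl_eq_zero_of_formB_self {hn : 2 ≤ n} {T : Affine.Simplex ℝ (E n) n}
    {q : Fin n → Poly n} (h : formB hn T q q = 0) : curl q = 0 := by
  ext1 j
  refine eq_zero_of_inner_H10_eq_zero T fun w => ?_
  rw [formB_self, Finset.sum_eq_zero_iff_of_nonneg fun _ _ => by positivity] at h
  have hj : (invLaplace hn T (curlL2 T q j)).1.snd = 0 := by simpa using h j (Finset.mem_univ j)
  have := inner_invLaplace hn T (curlL2 T q j) w
  rw [hj, inner_zero_left] at this
  exact this.symm

theorem formB_self_pos {hn : 2 ≤ n} (hn' : n ≤ 3) {T : Affine.Simplex ℝ (E n) n} {p : ℕ}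
    {q : Fin n → Poly n} (hq : q ∈ Q T p) (h0 : q ≠ 0) : 0 < formB hn T q q := by
  refine (formB_self_nonneg hn T q).lt_of_ne' fun h => h0 (vecL2_injective T q ?_)
  obtain ⟨v, hv, hvq⟩ := exists_grad_eq hq.1
    (pderiv_eq_of_curl_eq_zero hn hn' (curl_eq_zero_of_formB_self h))
  have := hq.2 v hv
  rwa [hvq, inner_self_eq_zero] at this

/-! ### The Rayleigh quotient -/

theorem continuous_bilin_self {V : Type*} [NormedAddCommGroup V] [NormedSpace ℝ V]
    [FiniteDimensional ℝ V] (a : V →ₗ[ℝ] V →ₗ[ℝ] ℝ) : Continuous fun x => a x x := by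
  have h : Continuous (LinearMap.toContinuousLinearMap.toLinearMap ∘ₗ a : V →ₗ[ℝ] V →L[ℝ] ℝ) :=
    LinearMap.continuous_of_finiteDimensional _
  exact h.clm_apply continuous_id

/-- The Rayleigh quotient of two quadratic forms attains its maximum. -/
theorem exists_forall_mul_le {V : Type*} [AddCommGroup V] [Module ℝ V] [FiniteDimensional ℝ V]
    [Nontrivial V] (a b : V →ₗ[ℝ] V →ₗ[ℝ] ℝ) (hb : ∀ x, x ≠ 0 → 0 < b x x) :
    ∃ x, x ≠ 0 ∧ ∀ y, a y y ≤ a x x / b x x * b y y := by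
  let e : EuclideanSpace ℝ (Fin (Module.finrank ℝ V)) ≃ₗ[ℝ] V :=
    LinearEquiv.ofFinrankEq _ _ (by simp)
  have : Nontrivial (EuclideanSpace ℝ (Fin (Module.finrank ℝ V))) := e.toEquiv.nontrivial
  have hca := continuous_bilin_self (a.compl₁₂ e.toLinearMap e.toLinearMap)
  have hcb := continuous_bilin_self (b.compl₁₂ e.toLinearMap e.toLinearMap)
  simp only [LinearMap.compl₁₂_apply, LinearEquiv.coe_coe] at hca hcb
  have hne : ∀ {x}, x ≠ 0 → e x ≠ 0 := fun h => e.map_ne_zero_iff.2 h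
  -- The quotient is homogeneous of degree 0, so its maximum on the compact unit sphere is global.
  obtain ⟨x, hx, hmax⟩ := (isCompact_sphere (0 : EuclideanSpace ℝ (Fin (Module.finrank ℝ V)))
    1).exists_isMaxOn (NormedSpace.sphere_nonempty.2 zero_le_one)
    (f := fun x => a (e x) (e x) / b (e x) (e x))
    (hca.continuousOn.div hcb.continuousOn fun x hx =>
      (hb _ (hne (ne_zero_of_mem_unit_sphere ⟨x, hx⟩))).ne')
  refine ⟨e x, hne (ne_zero_of_mem_unit_sphere ⟨x, hx⟩), fun y => ?_⟩
  obtain ⟨y, rfl⟩ := e.surjective y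
  rcases eq_or_ne y 0 with rfl | hy
  · simp
  · have hy' : (‖y‖⁻¹ • y) ∈ Metric.sphere (0 : EuclideanSpace ℝ (Fin (Module.finrank ℝ V))) 1 := by
      simp [norm_smul, hy]
    have h := hmax hy'
    have h0 : ‖y‖⁻¹ ≠ 0 := by simpa using hy
    simp only [Set.mem_ofPred_eq, map_smul, LinearMap.smul_apply, smul_eq_mul] at h
    rwa [mul_div_mul_left _ _ h0, mul_div_mul_left _ _ h0, div_le_iff₀ (hb _ (hne hy))] at h

/-- A maximizer of the Rayleigh quotient is an eigenvector. -/
theorem eq_mul_of_forall_le {V : Type*} [AddCommGroup V] [Module ℝ V]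
    (a b : V →ₗ[ℝ] V →ₗ[ℝ] ℝ) (ha : ∀ x y, a x y = a y x) (hb : ∀ x y, b x y = b y x)
    {μ : ℝ} {x : V} (hx : a x x = μ * b x x) (h : ∀ y, a y y ≤ μ * b y y) (y : V) :
    a x y = μ * b x y := by
  -- Maximality at `x + t y` gives a nonnegative quadratic in `t` without constant term; its
  -- discriminant forces the linear coefficient to vanish.
  have hd : ∀ t : ℝ, 0 ≤ (μ * b y y - a y y) * (t * t) + 2 * (μ * b x y - a x y) * t + 0 := by
    intro t
    have := h (x + t • y)
    simp only [map_add, map_smul, LinearMap.add_apply, LinearMap.smul_apply, smul_eq_mul,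
      ha y x, hb y x] at this
    linarith
  have := discrim_le_zero hd
  rw [discrim] at this
  nlinarith [sq_nonneg (μ * b x y - a x y)]

/-! ### The quotients -/

/-- `Q_p` as a subspace. -/
def subQ (T : Affine.Simplex ℝ (E n) n) (p : ℕ) : Submodule ℝ (Fin n → Poly n) :=
  vecP n p ⊓ (((P n (p + 1)).map (grad (n := n))).map (vecL2 T))ᗮ.comap (vecL2 T)

theorem mem_subQ {T : Affine.Simplex ℝ (E n) n} {p : ℕ} {q : Fin n → Poly n} :
    q ∈ subQ T p ↔ q ∈ Q T p := by
  refine and_congr Iff.rfl ?_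
  refine (Submodule.mem_orthogonal' _ _).trans ?_
  constructor
  · exact fun h v hv => h _ ⟨_, ⟨v, hv, rfl⟩, rfl⟩
  · rintro h _ ⟨_, ⟨v, hv, rfl⟩, rfl⟩
    exact h v hv

instance finite_subQ (T : Affine.Simplex ℝ (E n) n) (p : ℕ) : Module.Finite ℝ (subQ T p) :=
  Submodule.finiteDimensional_of_le (inf_le_left : _ ≤ vecP n p)

theorem exists_sub_grad_mem_Q (T : Affine.Simplex ℝ (E n) n) {p : ℕ} {q : Fin n → Poly n}
    (hq : q ∈ vecP n p) : ∃ v ∈ P n (p + 1), q - grad v ∈ Q T p := by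
  let K := ((P n (p + 1)).map (grad (n := n))).map (vecL2 T)
  obtain ⟨_, ⟨v, hv, rfl⟩, hv2⟩ : K.starProjection (vecL2 T q) ∈ K :=
    K.starProjection_apply_mem _
  refine ⟨v, hv, Submodule.sub_mem _ hq (grad_mem_vecP hv), fun w hw => ?_⟩
  rw [map_sub, hv2]
  exact K.starProjection_inner_eq_zero _ _ ⟨_, ⟨w, hw, rfl⟩, rfl⟩

/-- Pythagoras: `q - ∇v` is orthogonal to `∇(v - w)`. -/
theorem isLeast_distSqSet {T : Affine.Simplex ℝ (E n) n} {p : ℕ} {q : Fin n → Poly n} {v : Poly n}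
    (hv : v ∈ P n (p + 1)) (hq : q - grad v ∈ Q T p) :
    IsLeast (distSqSet T p q) (formA T (q - grad v) (q - grad v)) := by
  refine ⟨⟨v, hv, formA_self T _⟩, ?_⟩
  rintro _ ⟨w, hw, rfl⟩
  have e : q - grad w = (q - grad v) + grad (v - w) := by rw [map_sub]; abel
  rw [e, formA_self, map_add, norm_add_sq_real, hq.2 _ (Submodule.sub_mem _ hv hw)]
  nlinarith [sq_nonneg ‖vecL2 T (grad (v - w))‖]

theorem curl_sub_grad (q : Fin n → Poly n) (v : Poly n) : curl (q - grad v) = curl q := by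
  rw [sub_eq_add_neg, ← neg_one_smul ℝ (grad v), curl_add, curl_smul, curl_grad, smul_zero,
    add_zero]

theorem quotients_eq (hn : 2 ≤ n) (hn' : n ≤ 3) (T : Affine.Simplex ℝ (E n) n) (p : ℕ) :
    quotients T p = {x | ∃ q ∈ Q T p, q ≠ 0 ∧ x = formA T q q / formB hn T q q} := by
  ext x
  constructor
  · rintro ⟨q, hq, hc, rfl⟩
    obtain ⟨v, hv, hvq⟩ := exists_sub_grad_mem_Q T hq
    have hcurl := curl_sub_grad q v
    refine ⟨q - grad v, hvq, fun h => hc ?_, ?_⟩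
    · rw [← hcurl, h, ← zero_smul ℝ (0 : Fin n → Poly n), curl_smul, zero_smul]
    · have e : curlL2 T q = curlL2 T (q - grad v) := by
        ext1 j
        rw [curlL2, curlL2, hcurl]
      rw [(isLeast_distSqSet hv hvq).csInf_eq, e, dualNorm_curlL2_sq hn]
  · rintro ⟨q, hq, h0, rfl⟩
    refine ⟨q, hq.1, fun hc => (formB_self_pos (hn := hn) hn' hq h0).ne' ?_, ?_⟩
    · exact Finset.sum_eq_zero fun j _ => by rw [curlL2, hc]; simp
    · have h := isLeast_distSqSet (T := T) (p := p) (q := q) (Submodule.zero_mem _)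
        (by simpa using hq)
      rw [h.csInf_eq, dualNorm_curlL2_sq hn]
      simp

/-- A maximizer of the Rayleigh quotient is an eigenvector, and testing the eigenvalue equation with
`r = q` shows each eigenvalue to be a Rayleigh quotient. The nonzero `q₀` is essential: if `Q_p =
{0}`, both sets are empty and `mSq` is the default `sSup ∅ = 0`. -/
theorem isGreatest_mSq (hn : 2 ≤ n) (hn' : n ≤ 3) (T : Affine.Simplex ℝ (E n) n) {p : ℕ}
    {q₀ : Fin n → Poly n} (hq₀ : q₀ ∈ Q T p) (h0 : q₀ ≠ 0) :
    IsGreatest (quotients T p) (mSq T p) ∧ IsGreatest (eigenvalues hn T p) (mSq T p) := by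
  have : Nontrivial (subQ T p) :=
    ⟨⟨q₀, mem_subQ.2 hq₀⟩, 0, fun h => h0 (congrArg Subtype.val h)⟩
  let a := (bilinA T).compl₁₂ (subQ T p).subtype (subQ T p).subtype
  let b := (bilinB hn T).compl₁₂ (subQ T p).subtype (subQ T p).subtype
  have hpos : ∀ {q}, q ∈ Q T p → q ≠ 0 → 0 < formB hn T q q := fun h h0 => formB_self_pos hn' h h0
  obtain ⟨x, hx, hmax⟩ := exists_forall_mul_le a b fun x hx =>
    hpos (mem_subQ.1 x.2) fun h => hx (Subtype.ext h)
  have hx0 : x.1 ≠ 0 := fun h => hx (Subtype.ext h)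
  have hxQ := mem_subQ.1 x.2
  have hgr : IsGreatest (quotients T p) (formA T x x / formB hn T x x) := by
    rw [quotients_eq hn hn']
    refine ⟨⟨x, hxQ, hx0, rfl⟩, ?_⟩
    rintro _ ⟨q, hq, hq0, rfl⟩
    exact (div_le_iff₀ (hpos hq hq0)).2 (hmax ⟨q, mem_subQ.2 hq⟩)
  have hm : mSq T p = formA T x x / formB hn T x x := hgr.csSup_eq
  rw [hm]
  refine ⟨hgr, ⟨x, hxQ, hx0, fun r hr => ?_⟩, ?_⟩
  · exact eq_mul_of_forall_le a b (fun q r => formA_comm T q r) (fun q r => formB_comm hn T q r)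
      (div_mul_cancel₀ _ (hpos hxQ hx0).ne').symm hmax ⟨r, mem_subQ.2 hr⟩
  · rintro μ ⟨q, hq, hq0, h⟩
    refine hgr.2 ?_
    rw [quotients_eq hn hn']
    exact ⟨q, hq, hq0, by rw [h q hq, mul_div_cancel_right₀ _ (hpos hq hq0).ne']⟩

/-! ### The stability constant -/

theorem formB_self_le (hn : 2 ≤ n) (hn' : n ≤ 3) {T : Affine.Simplex ℝ (E n) n} {u : Pairs T}
    (hu : u ∈ H1 T) (r : Fin n → Poly n) : formB hn T r r ≤ ‖vecL2 T r - u.snd‖ ^ 2 := by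
  -- Testing with `w = (-Δ)⁻¹ curl r` gives `𝔟(r,r) ≤ √𝔟(r,r) ‖r - ∇u‖`; one root is then cancelled.
  have h := sum_inner_curl_le hn hn' hu r fun j => invLaplace hn T (curlL2 T r j)
  rw [← formB_self] at h
  change formB hn T r r ≤ _ at h
  have hs := Real.sq_sqrt (formB_self_nonneg hn T r)
  have h1 := Real.sqrt_nonneg (formB hn T r r)
  have h2 : √(formB hn T r r) ≤ ‖vecL2 T r - u.snd‖ := by
    rcases h1.eq_or_lt with h0 | h0
    · rw [← h0]; positivity
    · exact le_of_mul_le_mul_left (by rwa [← sq, hs]) h0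
  rw [← hs]
  gcongr

theorem formA_self_le (hn : 2 ≤ n) (hn' : n ≤ 3) (T : Affine.Simplex ℝ (E n) n) {p : ℕ}
    {r : Fin n → Poly n} (hr : r ∈ Q T p) (h0 : r ≠ 0) :
    formA T r r ≤ mSq T p * formB hn T r r := by
  have h := (isGreatest_mSq hn hn' T hr h0).1.2
  rw [quotients_eq hn hn'] at h
  exact (div_le_iff₀ (formB_self_pos hn' hr h0)).1 (h ⟨r, hr, h0, rfl⟩)

theorem mSq_nonneg (T : Affine.Simplex ℝ (E n) n) (p : ℕ) : 0 ≤ mSq T p := by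
  refine Real.sSup_nonneg ?_
  rintro _ ⟨q, -, -, rfl⟩
  refine div_nonneg (Real.sInf_nonneg ?_) (sq_nonneg _)
  rintro _ ⟨v, -, rfl⟩
  positivity

/-- If `r` is an orthogonal projection of `s` and has distance at least `‖r‖ / √m` to every
multiple of `s`, then `‖s‖ ≤ √m ‖s - r‖`. -/
theorem norm_sq_le_of_forall_le {V : Type*} [NormedAddCommGroup V] [InnerProductSpace ℝ V]
    {r s : V} {m : ℝ} (hr : r ≠ 0) (hrs : ⟪s - r, r⟫ = 0)
    (h : ∀ t : ℝ, ‖r‖ ^ 2 ≤ m * ‖r - t • s‖ ^ 2) : ‖s‖ ^ 2 ≤ m * ‖s - r‖ ^ 2 := by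
  have hsr : ⟪s, r⟫ = ‖r‖ ^ 2 := by
    rw [inner_sub_left, real_inner_self_eq_norm_sq] at hrs
    linarith
  have hr0 : 0 < ‖r‖ ^ 2 := by positivity
  have hs : s ≠ 0 := by
    rintro rfl
    rw [inner_zero_left] at hsr
    exact hr0.ne hsr
  have hs0 : 0 < ‖s‖ ^ 2 := by positivity
  -- As `⟪s, r⟫ = ‖r‖²`, this `t` minimizes `‖r - t s‖²`, with value `‖r‖² ‖s - r‖² / ‖s‖²`.
  have h1 := h (‖r‖ ^ 2 / ‖s‖ ^ 2)
  rw [norm_sub_sq_real, real_inner_smul_right, real_inner_comm, hsr, norm_smul, mul_pow,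
    Real.norm_eq_abs, sq_abs] at h1
  rw [norm_sub_sq_real, hsr]
  have e : ‖r‖ ^ 2 - 2 * (‖r‖ ^ 2 / ‖s‖ ^ 2 * ‖r‖ ^ 2) + (‖r‖ ^ 2 / ‖s‖ ^ 2) ^ 2 * ‖s‖ ^ 2
      = ‖r‖ ^ 2 * ((‖s‖ ^ 2 - ‖r‖ ^ 2) / ‖s‖ ^ 2) := by
    field_simp
    ring
  rw [e, mul_left_comm, le_mul_iff_one_le_right hr0, ← mul_div_assoc, le_div_iff₀ hs0] at h1
  linarith

theorem max_mem_stabilityConstants (hn : 2 ≤ n) (hn' : n ≤ 3) (T : Affine.Simplex ℝ (E n) n)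
    (p : ℕ) : max 1 (√(mSq T p)) ∈ stabilityConstants T p := by
  refine ⟨by positivity, fun u hu => ?_⟩
  obtain ⟨hg, -, hgal⟩ := (existsUnique_galerkin T (p + 1) u).choose_spec.1
  change galerkin T (p + 1) u ∈ _ at hg
  change ∀ w ∈ P n (p + 1), ⟪vecL2 T (grad (galerkin T (p + 1) u)), _⟫ = _ at hgal
  set g := galerkin T (p + 1) u
  obtain ⟨q, hq, hqp⟩ : proj T p u.snd ∈ (vecP n p).map (vecL2 T) :=
    Submodule.starProjection_apply_mem _ _
  have hperp : ∀ w ∈ vecP n p, ⟪u.snd - vecL2 T q, vecL2 T w⟫ = 0 := fun w hw => by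
    rw [hqp]
    exact Submodule.starProjection_inner_eq_zero _ _ ⟨w, hw, rfl⟩
  rw [← hqp]
  set r := q - grad g with hr
  set s := u.snd - vecL2 T (grad g) with hs
  have hsr : s - vecL2 T r = u.snd - vecL2 T q := by rw [hs, hr, map_sub]; abel
  have hrP : r ∈ vecP n p := Submodule.sub_mem _ hq (grad_mem_vecP hg)
  have hrQ : r ∈ Q T p := by
    refine ⟨hrP, fun w hw => ?_⟩
    have h1 := hperp _ (grad_mem_vecP hw)
    have h2 := hgal w hw
    rw [inner_sub_left] at h1
    rw [hr, map_sub, inner_sub_left]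
    linarith
  rw [← hsr]
  -- The case `r = 0` produces the 1 in the maximum. It also covers `Q_p = {0}`, where `mSq` carries
  -- no information.
  rcases eq_or_ne r 0 with h0 | h0
  · rw [h0, map_zero, sub_zero]
    exact le_mul_of_one_le_left (norm_nonneg _) (le_max_left _ _)
  · refine le_trans ?_ (mul_le_mul_of_nonneg_right (le_max_right _ _) (norm_nonneg _))
    have key : ‖s‖ ^ 2 ≤ mSq T p * ‖s - vecL2 T r‖ ^ 2 := by
      refine norm_sq_le_of_forall_le (fun h => h0 (vecL2_injective T r h)) ?_ fun t => ?_
      · rw [hsr]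
        exact hperp r hrP
      · rw [← formA_self]
        refine (formA_self_le hn hn' T hrQ h0).trans
          (mul_le_mul_of_nonneg_left ?_ (mSq_nonneg T p))
        -- The function `t (f - G f)` lies in `H¹` and has gradient `t s`.
        exact formB_self_le hn hn' (H1_smul (H1_sub hu (polyPair_mem_H1 T g)) t) r
    rw [← Real.sqrt_sq (norm_nonneg s), ← Real.sqrt_sq (norm_nonneg (s - vecL2 T r)),
      ← Real.sqrt_mul (mSq_nonneg T p)]
    exact Real.sqrt_le_sqrt key

/-- Each `f` imposes a closed condition on `C`, so the set of constants is closed and bounded below,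
and contains its infimum once nonempty. -/
theorem isLeast_Cst2 {T : Affine.Simplex ℝ (E n) n} {p : ℕ}
    (h : (stabilityConstants T p).Nonempty) : IsLeast (stabilityConstants T p) (Cst2 T p) := by
  have hbdd : BddBelow (stabilityConstants T p) := ⟨0, fun _ hC => hC.1⟩
  have hcl : IsClosed (stabilityConstants T p) := by
    simp only [stabilityConstants, Set.ofPred_and, Set.ofPred_forall]
    exact isClosed_Ici.inter (isClosed_iInter fun u => isClosed_iInter fun _ =>
      isClosed_le continuous_const (by fun_prop))
  exact hcl.isLeast_csInf h hbdd

theorem one_le_dimConst : 1 ≤ dimConst n := by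
  rw [dimConst]
  split_ifs
  · exact le_rfl
  · rw [le_div_iff₀ (by positivity), one_mul]
    exact Real.sqrt_le_iff.2 (by norm_num)

end StabConst

end
theorem theorem2p3 {n : ℕ} (hn : 2 ≤ n) (hn' : n ≤ 3)
    (T : Affine.Simplex ℝ (EuclideanSpace ℝ (Fin n)) n) (p : ℕ) :
    (∀ q ∈ StabConst.vecP n p,
        IsLeast (StabConst.distSqSet T p q) (sInf (StabConst.distSqSet T p q))) ∧
      (1 ≤ p →
        IsGreatest (StabConst.quotients T p) (StabConst.mSq T p) ∧
          IsGreatest (StabConst.eigenvalues hn T p) (StabConst.mSq T p)) ∧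
      IsLeast (StabConst.stabilityConstants T p) (StabConst.Cst2 T p) ∧
      StabConst.Cst2 T p ≤ max 1 (√(StabConst.mSq T p) * StabConst.dimConst n) := by
  have hmem := StabConst.max_mem_stabilityConstants hn hn' T p
  have hleast := StabConst.isLeast_Cst2 ⟨_, hmem⟩
  refine ⟨fun q hq => ?_, fun hp => ?_, hleast, (hleast.2 hmem).trans (max_le_max le_rfl ?_)⟩
  · obtain ⟨v, hv, hvq⟩ := StabConst.exists_sub_grad_mem_Q T hq
    have h := StabConst.isLeast_distSqSet hv hvq
    rwa [h.csInf_eq]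
  · obtain ⟨q, hq, hc⟩ := StabConst.exists_curl_ne_zero hn hn' hp
    obtain ⟨v, -, hvq⟩ := StabConst.exists_sub_grad_mem_Q T hq
    -- The part of `q` in `Q_p` is nonzero, since otherwise `q` would be a gradient and curl-free.
    refine StabConst.isGreatest_mSq hn hn' T hvq fun h => hc ?_
    rw [← sub_eq_zero.1 h |>.symm, StabConst.curl_grad]
  · exact le_mul_of_one_le_right (Real.sqrt_nonneg _) StabConst.one_le_dimConst
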